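/- **Setting.** Let $\mathcal B$ be a small category, $\mathcal G = \mathrm{Set}^{\mathcal B}$ the category of (covariant) functors $\mathcal B\to\mathrm{Set}$, and let $I$ be a finite directed multigraph (finitely many vertices $I_0$ and edges $I_1$) without directed cycles. A diagram $\mathcal D: I\to\mathcal G$ assigns to each vertex $i$ an object $\mathcal D_i$ and to each edge $d:i\to j$ a morphism $\mathcal D_d:\mathcal D_i\to\mathcal D_j$; a natural transformation $\tau:\mathcal E\Rightarrow\mathcal D$ of diagrams is a family $(\tau_i:\mathcal E_i\to\mathcal D_i)_i$ with $\tau_j\circ\mathcal E_d=\mathcal D_d\circ\tau_i$ for every edge $d:i\to j$, and it is *cartesian* if all these squares are pullbacks. $\Delta S$ is the constant diagram at $S$. A cocone $\kappa:\mathcal D\Rightarrow\Delta S$ is *colimiting* if every $\rho:\mathcal D\Rightarrow\Delta T$ equals $\Delta u\circ\kappa$ for a unique $u:S\to T$. It has the *Van Kampen property* if the functor $\kappa^*$ from the slice category $\mathcal G/S$ to the category of cartesian natural transformations into $\mathcal D$ (a full subcategory of the slice category of diagrams over $\mathcal D$), which pulls back morphisms $K\to S$ along the components $\kappa_i$, is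 an equivalence of categories. **Indices.** A vertex of $I$ is *minimal* if it has no outgoing edge and *branching* if it has at least two outgoing edges. A *branch* is a directed path in $I$ from a branching vertex to a minimal vertex. A minimal vertex is *affected* if it is the target of at least one branch; $Af(I)$ is the set of affected minimal vertices. For a directed path $p$ let $\mathcal D_p$ be the composite of the $\mathcal D_d$ along $p$. $\mathcal D$ is *image-disjoint* if $\mathcal D_p(y)\neq\mathcal D_{p'}(y)$, as elements of the disjoint union $\coprod_{k\in I_0}\mathcal D_k(X)$, for all different branches $p,p'$ with the same source $i$, all $X\in\mathcal B$ and all $y\in\mathcal D_i(X)$. **Paths.** Fix $X\in\mathcal B$. A *path segment* of sort $X$ is a triple $(y,d,y')$ or $(y',d^{op},y)$ with $d:i\to j$ an edge, $y\in\mathcal D_i(X)$ and $y'=\mathcal D_d(y)\in\mathcal D_j(X)$; two segments are *weakly equal* if they are equal or one is the reverse of the other (the reverse of $(y,\delta,y')$ is $(y',\delta^{op},y)$, with $(d^{op})^{op}=d$). A *mapping path* of sort $X$ from $z$ to $z'$ is a finite sequence of segments $(y_0,\delta_0,y_1),(y_1,\delta_1,y_2),\dots,(y_{n-1},\delta_{n-1},y_n)$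 with $y_0=z$, $y_n=z'$; the empty sequence is a path from each element to itself. Elements are taken in $\coprod_{i}\mathcal D_i(X)$, so that elements of different components are different. Paths are equal if they are equal as sequences. A path is *proper* if no two of its segments at different positions are weakly equal, and *inner-cycle free* if $y_i\neq y_j$ whenever $0\le i<j\le n$ and $j-i\le n-1$. **Theorem (Different paths connecting affected minimal components).** Let $\mathcal D:I\to\mathcal G$ be an image-disjoint diagram and $\kappa:\mathcal D\Rightarrow\Delta S$ a colimiting cocone. The following are equivalent: 1. $\kappa$ has the Van Kampen property. 2. For all $X\in\mathcal B$, all $i,j\in Af(I)$, all $z\in\mathcal D_i(X)$ and $z'\in\mathcal D_j(X)$, there are no two different proper mapping paths from $z$ to $z'$. 3. For all $X\in\mathcal B$, all $i,j\in Af(I)$, all $z\in\mathcal D_i(X)$ and $z'\in\mathcal D_j(X)$, there are no two different inner-cycle free proper mapping paths from $z$ to $z'$. -/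

import Mathlib

open CategoryTheory CategoryTheory.Limits

universe v₁ u₁ v u w

attribute [-instance] CategoryTheory.catToReflQuiver

namespace GraphVK

/-! ### Diagrams over a schema multigraph -/

/-- A diagram `D : I → C` on a directed multigraph `I`: a graph morphism from `I` to the underlying
graph of the category `C`. -/
structure Diagram (I : Type u₁) [Quiver.{v₁} I] (C : Type u) [Category.{v} C] where
  obj : I → C
  map : ∀ {i j : I}, (i ⟶ j) → (obj i ⟶ obj j)

namespace Diagram

variable {I : Type u₁} [Quiver.{v₁} I] {C : Type u} [Category.{v} C]

/-- A natural transformation between diagrams: a family of morphisms commuting with the morphisms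
given by the edges of `I`. -/
@[ext]
structure Hom (E D : Diagram I C) where
  app : ∀ i : I, E.obj i ⟶ D.obj i
  naturality : ∀ {i j : I} (d : i ⟶ j), E.map d ≫ app j = app i ≫ D.map d

/-- The category of diagrams and natural transformations. -/
instance : Category (Diagram I C) where
  Hom E D := Hom E D
  id D := { app := fun i => 𝟙 (D.obj i), naturality := fun d => by simp }
  comp f g :=
    { app := fun i => f.app i ≫ g.app i
      naturality := fun d => by
        rw [← Category.assoc, f.naturality, Category.assoc, g.naturality, Category.assoc] }
  id_comp f := Hom.ext (funext fun i => Category.id_comp (f.app i))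
  comp_id f := Hom.ext (funext fun i => Category.comp_id (f.app i))
  assoc f g h := Hom.ext (funext fun i => Category.assoc (f.app i) (g.app i) (h.app i))

@[simp] theorem id_app (D : Diagram I C) (i : I) : Hom.app (𝟙 D) i = 𝟙 (D.obj i) := rfl

@[simp] theorem comp_app {D E F : Diagram I C} (f : D ⟶ E) (g : E ⟶ F) (i : I) :
    Hom.app (f ≫ g) i = Hom.app f i ≫ Hom.app g i := rfl

theorem hom_ext {D E : Diagram I C} {f g : D ⟶ E} (h : ∀ i, Hom.app f i = Hom.app g i) : f = g :=
  Hom.ext (funext h)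

/-- The functor sending an object `S` to the constant diagram `ΔS`. -/
def const (I : Type u₁) [Quiver.{v₁} I] (C : Type u) [Category.{v} C] : C ⥤ Diagram I C where
  obj S := { obj := fun _ => S, map := fun _ => 𝟙 S }
  map f := { app := fun _ => f, naturality := fun _ => by simp }

/-- A natural transformation is cartesian if all its naturality squares are pullbacks. -/
def IsCartesian {E D : Diagram I C} (τ : E ⟶ D) : Prop :=
  ∀ {i j : I} (d : i ⟶ j), IsPullback (E.map d) (Hom.app τ i) (Hom.app τ j) (D.map d)

/-- The full subcategory of the category of diagrams over `D` whose objects are the cartesian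
natural transformations into `D`. -/
abbrev CartesianOver (D : Diagram I C) :=
  ObjectProperty.FullSubcategory (fun τ : Over D => IsCartesian τ.hom)

/-- The component `κ_i : D_i → S` of a commutative cocone `κ : D ⇒ ΔS`. -/
def leg {D : Diagram I C} {S : C} (κ : D ⟶ (const I C).obj S) (i : I) : D.obj i ⟶ S :=
  Hom.app κ i

theorem leg_w {D : Diagram I C} {S : C} (κ : D ⟶ (const I C).obj S) {i j : I} (d : i ⟶ j) :
    D.map d ≫ leg κ j = leg κ i :=
  (Hom.naturality κ d).trans (Category.comp_id _)

/-- A commutative cocone `κ : D ⇒ ΔS` is colimiting if every commutative cocone factors uniquely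
through it. -/
def IsColimiting {D : Diagram I C} {S : C} (κ : D ⟶ (const I C).obj S) : Prop :=
  ∀ (T : C) (ρ : D ⟶ (const I C).obj T), ∃! t : S ⟶ T, κ ≫ (const I C).map t = ρ

section Pullback

variable [HasPullbacks C] {D : Diagram I C} {S : C} (κ : D ⟶ (const I C).obj S)

/-- The morphism between the (chosen) pullbacks of `σ : K → S` along `κ_i` and `κ_j` induced by an
edge `d : i → j`. -/
noncomputable def pullbackEdge (σ : Over S) {i j : I} (d : i ⟶ j) :
    pullback (leg κ i) σ.hom ⟶ pullback (leg κ j) σ.hom :=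
  pullback.lift (pullback.fst (leg κ i) σ.hom ≫ D.map d) (pullback.snd (leg κ i) σ.hom)
    (by rw [Category.assoc, leg_w, pullback.condition])

@[simp] theorem pullbackEdge_fst (σ : Over S) {i j : I} (d : i ⟶ j) :
    pullbackEdge κ σ d ≫ pullback.fst (leg κ j) σ.hom = pullback.fst (leg κ i) σ.hom ≫ D.map d :=
  pullback.lift_fst _ _ _

@[simp] theorem pullbackEdge_snd (σ : Over S) {i j : I} (d : i ⟶ j) :
    pullbackEdge κ σ d ≫ pullback.snd (leg κ j) σ.hom = pullback.snd (leg κ i) σ.hom :=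
  pullback.lift_snd _ _ _

/-- The morphism between the (chosen) pullbacks of `σ` and `σ'` along `κ_i` induced by a morphism
over `S`. -/
noncomputable def pullbackComp {σ σ' : Over S} (γ : σ ⟶ σ') (i : I) :
    pullback (leg κ i) σ.hom ⟶ pullback (leg κ i) σ'.hom :=
  pullback.lift (pullback.fst (leg κ i) σ.hom) (pullback.snd (leg κ i) σ.hom ≫ γ.left)
    (by rw [Category.assoc, Over.w, pullback.condition])

@[simp] theorem pullbackComp_fst {σ σ' : Over S} (γ : σ ⟶ σ') (i : I) :
    pullbackComp κ γ i ≫ pullback.fst (leg κ i) σ'.hom = pullback.fst (leg κ i) σ.hom :=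
  pullback.lift_fst _ _ _

@[simp] theorem pullbackComp_snd {σ σ' : Over S} (γ : σ ⟶ σ') (i : I) :
    pullbackComp κ γ i ≫ pullback.snd (leg κ i) σ'.hom =
      pullback.snd (leg κ i) σ.hom ≫ γ.left :=
  pullback.lift_snd _ _ _

theorem pullbackComp_id (σ : Over S) (i : I) : pullbackComp κ (𝟙 σ) i = 𝟙 _ := by
  apply pullback.hom_ext <;> simp

theorem pullbackComp_comp {σ σ' σ'' : Over S} (γ : σ ⟶ σ') (γ' : σ' ⟶ σ'') (i : I) :
    pullbackComp κ (γ ≫ γ') i = pullbackComp κ γ i ≫ pullbackComp κ γ' i := by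
  apply pullback.hom_ext
  · rw [Category.assoc, pullbackComp_fst, pullbackComp_fst, pullbackComp_fst]
  · rw [Category.assoc, pullbackComp_snd, pullbackComp_snd, ← Category.assoc, pullbackComp_snd,
      Category.assoc, Over.comp_left]

theorem pullbackComp_naturality {σ σ' : Over S} (γ : σ ⟶ σ') {i j : I} (d : i ⟶ j) :
    pullbackEdge κ σ d ≫ pullbackComp κ γ j = pullbackComp κ γ i ≫ pullbackEdge κ σ' d := by
  apply pullback.hom_ext
  · rw [Category.assoc, Category.assoc, pullbackComp_fst, pullbackEdge_fst, pullbackEdge_fst,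
      ← Category.assoc, pullbackComp_fst]
  · rw [Category.assoc, Category.assoc, pullbackComp_snd, pullbackEdge_snd, pullbackComp_snd,
      ← Category.assoc, pullbackEdge_snd]

theorem pullbackEdge_isPullback (σ : Over S) {i j : I} (d : i ⟶ j) :
    IsPullback (pullbackEdge κ σ d) (pullback.fst (leg κ i) σ.hom)
      (pullback.fst (leg κ j) σ.hom) (D.map d) := by
  refine IsPullback.of_right (h₁₂ := pullback.snd (leg κ j) σ.hom)
    (h₂₂ := leg κ j) (v₁₃ := σ.hom) ?_ (pullbackEdge_fst κ σ d)
    (IsPullback.of_hasPullback (leg κ j) σ.hom).flip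
  rw [pullbackEdge_snd, leg_w]
  exact (IsPullback.of_hasPullback (leg κ i) σ.hom).flip

/-- The diagram of the pullbacks of `σ : K → S` along the components of a cocone. -/
noncomputable def pullbackDiagram (σ : Over S) : Diagram I C where
  obj i := pullback (leg κ i) σ.hom
  map d := pullbackEdge κ σ d

/-- The projections of the pullbacks, as a natural transformation into `D`. -/
noncomputable def pullbackHom (σ : Over S) : pullbackDiagram κ σ ⟶ D where
  app i := pullback.fst (leg κ i) σ.hom
  naturality d := pullbackEdge_fst κ σ d

/-- The natural transformation induced on pullbacks by a morphism over `S`. -/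
noncomputable def pullbackMap {σ σ' : Over S} (γ : σ ⟶ σ') :
    pullbackDiagram κ σ ⟶ pullbackDiagram κ σ' where
  app i := pullbackComp κ γ i
  naturality d := pullbackComp_naturality κ γ d

/-- The functor `κ^*`, pulling back morphisms into `S` along the components of a cocone
`κ : D ⇒ ΔS`. -/
noncomputable def pullbackFunctor : Over S ⥤ CartesianOver D where
  obj σ := ⟨Over.mk (pullbackHom κ σ), fun d => pullbackEdge_isPullback κ σ d⟩
  map γ := ObjectProperty.homMk (Over.homMk (pullbackMap κ γ)
    (hom_ext fun i => pullbackComp_fst κ γ i))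
  map_id σ := ObjectProperty.hom_ext _ (Over.OverMorphism.ext
    (hom_ext fun i => pullbackComp_id κ σ i))
  map_comp γ γ' := ObjectProperty.hom_ext _ (Over.OverMorphism.ext
    (hom_ext fun i => pullbackComp_comp κ γ γ' i))

/-- A cocone `κ : D ⇒ ΔS` has the Van Kampen property if `κ^*` is an equivalence of
categories. -/
def IsVanKampen : Prop := (pullbackFunctor κ).IsEquivalence

end Pullback

end Diagram

/-! ### Mapping paths -/

section MappingPath

variable {I : Type u₁} [Quiver.{v₁} I] {B : Type u} [Category.{v} B]

/-- The elements of sort `X`: the disjoint union of the sets `D_i(X)`. -/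
abbrev Elem (D : Diagram I (B ⥤ Type w)) (X : B) := Σ i : I, (D.obj i).obj X

/-- The map on elements of sort `X` induced by an edge. -/
def edgeMap (D : Diagram I (B ⥤ Type w)) (X : B) {i j : I} (d : i ⟶ j)
    (y : (D.obj i).obj X) : (D.obj j).obj X :=
  (D.map d).app X y

/-- Edges `d` of `I` (`inl`) together with formal opposites `d^op` (`inr`). -/
abbrev SignedEdge (I : Type u₁) [Quiver.{v₁} I] := Quiver.Total I ⊕ Quiver.Total I

/-- The path segments `(y, δ, y')` of sort `X`. -/
@[ext]
structure PathSegment (D : Diagram I (B ⥤ Type w)) (X : B) where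
  fst : Elem D X
  edge : SignedEdge I
  snd : Elem D X
  valid : match edge with
    | .inl d => ∃ y : (D.obj d.left).obj X,
        fst = ⟨d.left, y⟩ ∧ snd = ⟨d.right, edgeMap D X d.hom y⟩
    | .inr d => ∃ y' : (D.obj d.left).obj X,
        snd = ⟨d.left, y'⟩ ∧ fst = ⟨d.right, edgeMap D X d.hom y'⟩

variable {D : Diagram I (B ⥤ Type w)} {X : B}

/-- Segments `(y₁, δ₁, y₁')`, `(y₂, δ₂, y₂')` are weakly equal if they are equal or
`(y₁, δ₁, y₁') = (y₂', δ₂^op, y₂)`. -/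
def WeaklyEqual (s t : PathSegment D X) : Prop :=
  s = t ∨ (s.fst = t.snd ∧ s.edge = t.edge.swap ∧ s.snd = t.fst)

/-- `Connects P z z'`: the list `P` of path segments is a mapping path from `z` to `z'`. The empty
path connects every element with itself. -/
def Connects : List (PathSegment D X) → Elem D X → Elem D X → Prop
  | [], z, z' => z = z'
  | s :: P, z, z' => s.fst = z ∧ Connects P s.snd z'

/-- A mapping path is proper if no two segments (at different positions) are weakly equal. -/
def IsProper (P : List (PathSegment D X)) : Prop :=
  P.Pairwise fun s t => ¬ WeaklyEqual s t

/-- The elements `y_0, …, y_n` visited by a mapping path of length `n ≥ 1`. -/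
def visited : List (PathSegment D X) → List (Elem D X)
  | [] => []
  | s :: P => s.fst :: (s :: P).map PathSegment.snd

/-- A mapping path of length `n` is inner-cycle free if `y_i ≠ y_j` for all `0 ≤ i < j ≤ n` with
`j - i ≤ n - 1`. -/
def IsInnerCycleFree (P : List (PathSegment D X)) : Prop :=
  ∀ i j : ℕ, i < j → j ≤ P.length → j - i < P.length → (visited P)[i]? ≠ (visited P)[j]?

end MappingPath

/-! ### Minimal, branching and affected indices -/

section Indices

variable {I : Type u₁} [Quiver.{v₁} I]

/-- A multigraph has no directed cycles: every closed directed path is the empty one. -/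
def NoDirectedCycles (I : Type u₁) [Quiver.{v₁} I] : Prop :=
  ∀ (i : I) (p : Quiver.Path i i), p = Quiver.Path.nil

/-- Minimal indices: vertices without outgoing edges. -/
def IsMinimal (i : I) : Prop := ∀ j : I, IsEmpty (i ⟶ j)

/-- Branching indices: vertices with at least two outgoing edges. -/
def IsBranching (i : I) : Prop := ∃ e e' : (Σ j : I, i ⟶ j), e ≠ e'

/-- Affected minimal indices: minimal indices that are the target of at least one branch, i.e. of a
directed path from a branching index to a minimal index. -/
def IsAffected (j : I) : Prop :=
  IsMinimal j ∧ ∃ i : I, IsBranching i ∧ Nonempty (Quiver.Path i j)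

/-- The map `D_p` on elements of sort `X`, for a directed path `p` in `I`. -/
def pathMap {B : Type u} [Category.{v} B] (D : Diagram I (B ⥤ Type w)) (X : B) {i : I} :
    ∀ {j : I}, Quiver.Path i j → (D.obj i).obj X → (D.obj j).obj X
  | _, .nil, y => y
  | _, .cons p d, y => edgeMap D X d (pathMap D X p y)

/-- A diagram is image disjoint if different branches with a common source never send an element to
the same element. -/
def ImageDisjoint {B : Type u} [Category.{v} B] (D : Diagram I (B ⥤ Type w)) : Prop :=
  ∀ (i j j' : I) (p : Quiver.Path i j) (p' : Quiver.Path i j'),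
    IsBranching i → IsMinimal j → IsMinimal j' →
    (⟨j, p⟩ : Σ k : I, Quiver.Path i k) ≠ ⟨j', p'⟩ →
    ∀ (X : B) (y : (D.obj i).obj X),
      (⟨j, pathMap D X p y⟩ : Elem D X) ≠ ⟨j', pathMap D X p' y⟩

end Indices

end GraphVK

/-! For each sort X, the elements form a graph: its undirected edges are pairs of an edge d of I and
an element of the source of d. A mapping path is a walk in this graph, and it is proper when it uses
no undirected edge twice. Given image-disjointness, each of the three conditions says that these
graphs contain no simple closed walk.

From 1 to 2: each undirected edge k defines a double covering of the diagram whose two sheets are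
swapped along k. It is a cartesian transformation, so the Van Kampen property makes it a pullback
from S, and therefore it has no monodromy. Hence parallel paths cross k with the same parity
(`parity_eq_of_isVanKampen`), and parallel proper paths coincide (`path_unique_of_isVanKampen`).
Condition 3 is a special case of condition 2.

From 3 to 1: `not_isSimpleClosed` turns a simple closed path into two different paths between
affected minimal elements. A top vertex of the closed path has two different outgoing edges.
Image-disjointness keeps everything below the one apart from everything below the other, so descents
on both sides extend the two arcs of the closed path to minimal elements without creating
repetitions. Without simple closed paths, a walk upstairs in a cartesian transformation that returns
to its fibre returns to its starting point (`eq_of_connects_of_elemMap_eq`), so the transformation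
descends to its connected components over S (`pullbackFunctor_essSurj`). Full faithfulness of κ^*
needs only that colimits of presheaves are universal (`isColimiting_pullbackProj`). -/

namespace GraphVK

/-! ### Mapping paths as walks in the graph of elements. -/

section PathCalculus

variable {I : Type u₁} [Quiver.{v₁} I] {B : Type u} [Category.{v} B]
  {D : Diagram I (B ⥤ Type w)} {X : B}

namespace PathSegment

/-- The segment `(y, d, D_d(y))`. -/
def forward {i j : I} (d : i ⟶ j) (y : (D.obj i).obj X) : PathSegment D X :=
  ⟨⟨i, y⟩, .inl ⟨i, j, d⟩, ⟨j, edgeMap D X d y⟩, y, rfl, rfl⟩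

/-- The segment `(D_d(y), d^op, y)`. -/
def backward {i j : I} (d : i ⟶ j) (y : (D.obj i).obj X) : PathSegment D X :=
  ⟨⟨j, edgeMap D X d y⟩, .inr ⟨i, j, d⟩, ⟨i, y⟩, y, rfl, rfl⟩

theorem eq_forward_or_backward (s : PathSegment D X) :
    (∃ (i j : I) (d : i ⟶ j) (y : (D.obj i).obj X), s = forward d y) ∨
      ∃ (i j : I) (d : i ⟶ j) (y : (D.obj i).obj X), s = backward d y := by
  obtain ⟨a, e | e, b, h⟩ := s
  · obtain ⟨y, rfl, rfl⟩ := h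
    exact .inl ⟨_, _, e.hom, y, rfl⟩
  · obtain ⟨y, rfl, rfl⟩ := h
    exact .inr ⟨_, _, e.hom, y, rfl⟩

/-- The reverse of a path segment. -/
def rev (s : PathSegment D X) : PathSegment D X where
  fst := s.snd
  edge := s.edge.swap
  snd := s.fst
  valid := by
    obtain ⟨i, j, d, y, rfl⟩ | ⟨i, j, d, y, rfl⟩ := s.eq_forward_or_backward <;>
      exact ⟨y, rfl, rfl⟩

/-- The underlying undirected edge of the graph of elements: an edge of `I` together with an
element of its source. -/
def key (s : PathSegment D X) : Quiver.Total I × Elem D X :=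
  match s.edge with
  | .inl d => (d, s.fst)
  | .inr d => (d, s.snd)

theorem key_rev (s : PathSegment D X) : s.rev.key = s.key := by
  obtain ⟨i, j, d, y, rfl⟩ | ⟨i, j, d, y, rfl⟩ := s.eq_forward_or_backward <;> rfl

end PathSegment

open PathSegment

/-- An edge of I and an element of its source determine the target, so `key` forgets exactly the
orientation of a segment. Properness thereby becomes `Nodup` of a list of keys, which is stable
under permutation. -/
theorem weaklyEqual_iff_key_eq {s t : PathSegment D X} : WeaklyEqual s t ↔ s.key = t.key := by
  constructor
  · rintro (rfl | ⟨h₁, h₂, h₃⟩)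
    · rfl
    · have : s = t.rev := PathSegment.ext h₁ h₂ h₃
      rw [this, key_rev]
  · obtain ⟨i, j, d, y, rfl⟩ | ⟨i, j, d, y, rfl⟩ := s.eq_forward_or_backward <;>
    obtain ⟨i', j', d', y', rfl⟩ | ⟨i', j', d', y', rfl⟩ := t.eq_forward_or_backward <;>
    · intro h
      obtain ⟨h₁, h₂⟩ := Prod.ext_iff.1 h
      simp only [key, forward, backward] at h₁ h₂
      cases h₁
      cases h₂
      first
      | exact .inl rfl
      | exact .inr ⟨rfl, rfl, rfl⟩

theorem isProper_iff_nodup {P : List (PathSegment D X)} :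
    IsProper P ↔ (P.map key).Nodup := by
  rw [IsProper, List.Nodup, List.pairwise_map]
  simp only [weaklyEqual_iff_key_eq, ne_eq]

theorem connects_append {P Q : List (PathSegment D X)} {z z' : Elem D X} :
    Connects (P ++ Q) z z' ↔ ∃ m, Connects P z m ∧ Connects Q m z' := by
  induction P generalizing z with
  | nil => simp [Connects]
  | cons s P ih => simp [Connects, ih, and_assoc]

theorem connects_singleton (s : PathSegment D X) : Connects [s] s.fst s.snd := ⟨rfl, rfl⟩

theorem Connects.append {P Q : List (PathSegment D X)} {z m z' : Elem D X}
    (hP : Connects P z m) (hQ : Connects Q m z') : Connects (P ++ Q) z z' :=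
  connects_append.2 ⟨m, hP, hQ⟩

theorem Connects.end_mem {P : List (PathSegment D X)} {z z' : Elem D X} (h : Connects P z z') :
    z' ∈ z :: P.map PathSegment.snd := by
  induction P generalizing z with
  | nil => simp [show z = z' from h]
  | cons s P ih => exact List.mem_cons_of_mem _ (ih h.2)

theorem Connects.fst_mem {P : List (PathSegment D X)} {z z' : Elem D X} (h : Connects P z z')
    {s : PathSegment D X} (hs : s ∈ P) : s.fst ∈ z :: P.map PathSegment.snd := by
  induction P generalizing z with
  | nil => simp at hs
  | cons t P ih =>
    rcases List.mem_cons.1 hs with rfl | hs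
    · simp [h.1]
    · exact List.mem_cons_of_mem _ (ih h.2 hs)

/-- The reverse of a mapping path. -/
def revPath (P : List (PathSegment D X)) : List (PathSegment D X) := (P.map rev).reverse

theorem Connects.revPath {P : List (PathSegment D X)} {z z' : Elem D X} (h : Connects P z z') :
    Connects (revPath P) z' z := by
  induction P generalizing z with
  | nil => exact (show z = z' from h).symm
  | cons s P ih =>
    rw [GraphVK.revPath, List.map_cons, List.reverse_cons]
    refine (ih h.2).append ⟨rfl, h.1⟩

theorem vertices_revPath {P : List (PathSegment D X)} {z z' : Elem D X} (h : Connects P z z') :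
    z' :: (revPath P).map PathSegment.snd = (z :: P.map PathSegment.snd).reverse := by
  induction P generalizing z with
  | nil => simp [revPath, show z = z' from h]
  | cons s P ih =>
    rw [List.map_cons, List.reverse_cons, ← ih h.2]
    simp [revPath, rev, h.1]

/-- Equal segments have a common end, and a segment reversed later makes the walk return to its
start; either way a vertex repeats. -/
theorem isProper_of_nodup {P : List (PathSegment D X)} {z z' : Elem D X} (h : Connects P z z')
    (hP : (z :: P.map PathSegment.snd).Nodup) : IsProper P := by
  induction P generalizing z with
  | nil => exact List.Pairwise.nil
  | cons s P ih =>
    rw [List.nodup_cons] at hP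
    refine List.Pairwise.cons (fun t ht hst => ?_) (ih h.2 hP.2)
    rcases hst with rfl | ⟨h₁, -, -⟩
    · exact (List.nodup_cons.1 hP.2).1 (List.mem_map_of_mem ht)
    · refine hP.1 (List.mem_cons_of_mem _ ?_)
      rw [← h.1, h₁]
      exact List.mem_map_of_mem ht

theorem isInnerCycleFree_of_nodup {P : List (PathSegment D X)} {z z' : Elem D X}
    (h : Connects P z z') (hP : (z :: P.map PathSegment.snd).Nodup) : IsInnerCycleFree P := by
  intro i j hij hj hlt
  cases P with
  | nil => simp at hlt
  | cons s P =>
    rw [visited, h.1]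
    exact fun heq => hij.ne ((List.getElem?_inj
      (by simp only [List.length_cons, List.length_map] at *; omega) hP).1 heq)

end PathCalculus

/-! ### The descent relation on elements -/

section Descent

variable {I : Type u₁} [Quiver.{v₁} I]

theorem exists_path_of_transGen {i j : I}
    (h : Relation.TransGen (fun i j : I => Nonempty (i ⟶ j)) i j) :
    ∃ p : Quiver.Path i j, p.length ≠ 0 := by
  induction h with
  | single h => exact ⟨h.some.toPath, by simp⟩
  | tail _ h ih => exact ⟨ih.choose.cons h.some, by simp⟩

theorem NoDirectedCycles.irrefl (hI : NoDirectedCycles I) (i : I) :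
    ¬ Relation.TransGen (fun i j : I => Nonempty (i ⟶ j)) i i := fun h => by
  obtain ⟨p, hp⟩ := exists_path_of_transGen h
  exact hp (by rw [hI i p]; rfl)

theorem NoDirectedCycles.wellFounded [Finite I] (hI : NoDirectedCycles I) :
    WellFounded (fun i j : I => Nonempty (i ⟶ j)) := by
  have : Std.Irrefl (Relation.TransGen (fun i j : I => Nonempty (i ⟶ j))) := ⟨hI.irrefl⟩
  exact Subrelation.wf (fun {i j} (h : Nonempty (i ⟶ j)) => Relation.TransGen.single h)
    (Finite.wellFounded_of_trans_of_irrefl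
      (Relation.TransGen (fun i j : I => Nonempty (i ⟶ j))))

theorem NoDirectedCycles.wellFounded_swap [Finite I] (hI : NoDirectedCycles I) :
    WellFounded (fun i j : I => Nonempty (j ⟶ i)) := by
  have : Std.Irrefl (fun i j : I => Relation.TransGen (fun i j : I => Nonempty (i ⟶ j)) j i) :=
    ⟨hI.irrefl⟩
  have : IsTrans I (fun i j : I => Relation.TransGen (fun i j : I => Nonempty (i ⟶ j)) j i) :=
    ⟨fun _ _ _ h h' => h'.trans h⟩
  exact Subrelation.wf (fun {i j} (h : Nonempty (j ⟶ i)) => Relation.TransGen.single h)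
    (Finite.wellFounded_of_trans_of_irrefl
      (fun i j : I => Relation.TransGen (fun i j : I => Nonempty (i ⟶ j)) j i))

variable {B : Type u} [Category.{v} B] {D : Diagram I (B ⥤ Type w)} {X : B}

/-- `Step e e'`: some edge of `I` sends the element `e` to `e'`. -/
def Step (e e' : Elem D X) : Prop := ∃ d : e.1 ⟶ e'.1, edgeMap D X d e.2 = e'.2

theorem step_edgeMap {i j : I} (d : i ⟶ j) (y : (D.obj i).obj X) :
    Step (D := D) (X := X) ⟨i, y⟩ ⟨j, edgeMap D X d y⟩ := ⟨d, rfl⟩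

theorem NoDirectedCycles.wellFounded_step [Finite I] (hI : NoDirectedCycles I) :
    WellFounded (Step (D := D) (X := X)) :=
  Subrelation.wf (fun ⟨d, _⟩ => ⟨d⟩) (InvImage.wf (fun e : Elem D X => e.1) hI.wellFounded)

theorem NoDirectedCycles.wellFounded_step_swap [Finite I] (hI : NoDirectedCycles I) :
    WellFounded (Function.swap (Step (D := D) (X := X))) :=
  Subrelation.wf (fun ⟨d, _⟩ => ⟨d⟩) (InvImage.wf (fun e : Elem D X => e.1) hI.wellFounded_swap)

theorem NoDirectedCycles.not_transGen_step_self [Finite I] (hI : NoDirectedCycles I)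
    (e : Elem D X) : ¬ Relation.TransGen Step e e :=
  (hI.wellFounded_step (D := D) (X := X)).transGen.irrefl.irrefl e

theorem exists_pathMap_eq {e e' : Elem D X} (h : Relation.ReflTransGen Step e e') :
    ∃ p : Quiver.Path e.1 e'.1, pathMap D X p e.2 = e'.2 := by
  induction h with
  | refl => exact ⟨.nil, rfl⟩
  | tail _ h ih =>
    obtain ⟨p, hp⟩ := ih
    obtain ⟨d, hd⟩ := h
    exact ⟨p.cons d, by rw [pathMap, hp, hd]⟩

/-- A directed walk from an arbitrary element down to an element of minimal index. -/
theorem exists_descent [Finite I] (hI : NoDirectedCycles I) (c : Elem D X) :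
    ∃ (z : Elem D X) (P : List (PathSegment D X)), IsMinimal z.1 ∧
      Relation.ReflTransGen Step c z ∧ Connects P c z ∧
      (∀ e ∈ P.map PathSegment.snd, Relation.TransGen Step c e) ∧
      (c :: P.map PathSegment.snd).Nodup := by
  induction c using (hI.wellFounded_step_swap (D := D) (X := X)).induction with
  | _ c ih =>
    by_cases hc : IsMinimal c.1
    · exact ⟨c, [], hc, .refl, rfl, by simp, by simp⟩
    · obtain ⟨j, ⟨d⟩⟩ : ∃ j, Nonempty (c.1 ⟶ j) := by
        simpa [IsMinimal, not_isEmpty_iff] using hc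
      have hs := step_edgeMap (D := D) (X := X) d c.2
      obtain ⟨z, P, hz, hcz, hP, hlt, hnd⟩ := ih ⟨j, edgeMap D X d c.2⟩ hs
      have hlt' : ∀ e ∈ (PathSegment.forward d c.2 :: P).map PathSegment.snd,
          Relation.TransGen Step c e := by
        intro e he
        rcases List.mem_cons.1 he with rfl | he
        · exact .single hs
        · exact (Relation.TransGen.single hs).trans (hlt e he)
      refine ⟨z, PathSegment.forward d c.2 :: P, hz, .head hs hcz, ⟨rfl, hP⟩, hlt', ?_⟩
      exact List.nodup_cons.2 ⟨fun h => hI.not_transGen_step_self c (hlt' c h), hnd⟩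

/-- The last exit from a set of elements, among all directed walks starting at `c`. -/
theorem exists_last_exit [Finite I] (hI : NoDirectedCycles I) (V : Elem D X → Prop) (c : Elem D X)
    (hc : V c) : ∃ c₀, V c₀ ∧ Relation.ReflTransGen Step c c₀ ∧
      ∀ e, Relation.TransGen Step c₀ e → ¬ V e := by
  induction c using (hI.wellFounded_step_swap (D := D) (X := X)).transGen.induction with
  | _ c ih =>
    by_cases h : ∃ e, Relation.TransGen Step c e ∧ V e
    · obtain ⟨e, hce, he⟩ := h
      obtain ⟨c₀, h₁, h₂, h₃⟩ := ih e (Relation.transGen_swap.2 hce) he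
      exact ⟨c₀, h₁, hce.to_reflTransGen.trans h₂, h₃⟩
    · exact ⟨c, hc, .refl, fun e h₁ h₂ => h ⟨e, h₁, h₂⟩⟩

/-- The first edge of a directed path. -/
def firstEdge {i : I} : ∀ {j : I}, Quiver.Path i j → Option (Σ k : I, i ⟶ k)
  | _, .nil => none
  | _, .cons p d =>
    match p, d with
    | .nil, d => some ⟨_, d⟩
    | .cons p d', _ => firstEdge (.cons p d')

/-- `Quiver.Path` grows at its end, so this is what tells apart two branches that start with
different edges. -/
theorem firstEdge_comp {i j k : I} (d : i ⟶ j) (p : Quiver.Path j k) :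
    firstEdge (d.toPath.comp p) = some ⟨j, d⟩ := by
  induction p with
  | nil => rfl
  | cons p e ih =>
    rw [Quiver.Path.comp_cons]
    cases p with
    | nil => rfl
    | cons p e' => exact ih

theorem pathMap_toPath_comp {i j k : I} (d : i ⟶ j) (p : Quiver.Path j k)
    (y : (D.obj i).obj X) :
    pathMap D X (d.toPath.comp p) y = pathMap D X p (edgeMap D X d y) := by
  induction p with
  | nil => rfl
  | cons p e ih => rw [Quiver.Path.comp_cons, pathMap, ih]; rfl

/-- A common element below both images could be followed down to a minimal index. This would give
two branches out of i, different in their first edge, with the same value at y. -/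
theorem ImageDisjoint.not_reach [Finite I] (hI : NoDirectedCycles I) (hD : ImageDisjoint D)
    {i j j' : I} {d : i ⟶ j} {d' : i ⟶ j'} (hd : (⟨j, d⟩ : Σ k : I, i ⟶ k) ≠ ⟨j', d'⟩)
    (y : (D.obj i).obj X) {e : Elem D X}
    (h : Relation.ReflTransGen Step ⟨j, edgeMap D X d y⟩ e) :
    ¬ Relation.ReflTransGen Step ⟨j', edgeMap D X d' y⟩ e := fun h' => by
  obtain ⟨z, -, hz, hez, -⟩ := exists_descent hI e
  obtain ⟨p, hp⟩ := exists_pathMap_eq (h.trans hez)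
  obtain ⟨p', hp'⟩ := exists_pathMap_eq (h'.trans hez)
  refine hD i z.1 z.1 (d.toPath.comp p) (d'.toPath.comp p') ⟨_, _, hd⟩ hz hz (fun heq => hd ?_) X y ?_
  · have heq : d.toPath.comp p = d'.toPath.comp p' := by simpa using heq
    have := congrArg firstEdge heq
    rwa [firstEdge_comp, firstEdge_comp, Option.some_inj] at this
  · rw [pathMap_toPath_comp, pathMap_toPath_comp, hp, hp']

end Descent

/-! ### Simple closed paths -/

section SimpleClosed

variable {I : Type u₁} [Quiver.{v₁} I] {B : Type u} [Category.{v} B]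
  {D : Diagram I (B ⥤ Type w)} {X : B}

/-- A nonempty proper closed mapping path at `z` visiting no element twice. -/
structure IsSimpleClosed (P : List (PathSegment D X)) (z : Elem D X) : Prop where
  ne_nil : P ≠ []
  connects : Connects P z z
  proper : IsProper P
  nodup : (P.map PathSegment.snd).Nodup

namespace IsSimpleClosed

/-- Both repetition conditions depend only on the cyclic sequence of segments, so any vertex may
serve as base. Distinct vertices alone would not suffice as a definition: a segment followed by its
reverse also visits two different ends. -/
theorem rotate {P Q : List (PathSegment D X)} {z m : Elem D X} (h : IsSimpleClosed (P ++ Q) z)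
    (hP : Connects P z m) (hQ : Connects Q m z) : IsSimpleClosed (Q ++ P) m where
  ne_nil h' := h.ne_nil (by simp_all)
  connects := hQ.append hP
  proper := by
    have := h.proper
    rw [isProper_iff_nodup] at this ⊢
    exact (List.perm_append_comm.map _).nodup_iff.1 this
  nodup := (List.perm_append_comm.map _).nodup_iff.1 h.nodup

variable {P : List (PathSegment D X)} {z : Elem D X}

theorem base_mem (h : IsSimpleClosed P z) : z ∈ P.map PathSegment.snd := by
  obtain ⟨hne, hc, -, -⟩ := h
  cases P with
  | nil => exact absurd rfl hne
  | cons s P => exact hc.2.end_mem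

theorem fst_mem (h : IsSimpleClosed P z) {s : PathSegment D X} (hs : s ∈ P) :
    s.fst ∈ P.map PathSegment.snd := by
  rcases List.mem_cons.1 (h.connects.fst_mem hs) with h' | h'
  · rw [h']
    exact h.base_mem
  · exact h'

theorem exists_rotate (h : IsSimpleClosed P z) {m : Elem D X}
    (hm : m ∈ P.map PathSegment.snd) : ∃ Q, IsSimpleClosed Q m ∧
      ∀ e, e ∈ Q.map PathSegment.snd ↔ e ∈ P.map PathSegment.snd := by
  obtain ⟨s, hs, rfl⟩ := List.mem_map.1 hm
  obtain ⟨L, R, rfl⟩ := List.append_of_mem hs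
  rw [List.append_cons] at h ⊢
  obtain ⟨m, hL, hR⟩ := connects_append.1 h.connects
  obtain ⟨m', hL', rfl, hm'⟩ := connects_append.1 hL
  obtain rfl : s.snd = m := hm'
  exact ⟨_, h.rotate hL hR, fun e => (List.perm_append_comm.map _).mem_iff⟩

/-- A simple closed path splits at a second vertex into two arcs. -/
theorem exists_arcs (h : IsSimpleClosed P z) {m : Elem D X}
    (hm : m ∈ P.map PathSegment.snd) (hne : z ≠ m) :
    ∃ A C, A ≠ C ∧ Connects A z m ∧ Connects C z m ∧
      (z :: A.map PathSegment.snd).Nodup ∧ (z :: C.map PathSegment.snd).Nodup ∧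
      (∀ e ∈ A.map PathSegment.snd, e ∈ P.map PathSegment.snd) ∧
      (∀ e ∈ C.map PathSegment.snd, e ∈ P.map PathSegment.snd) := by
  obtain ⟨s, hs, rfl⟩ := List.mem_map.1 hm
  obtain ⟨L, R, rfl⟩ := List.append_of_mem hs
  have hbase := h.base_mem
  rw [List.append_cons] at h hbase ⊢
  set A := L ++ [s] with hA
  obtain ⟨m, hL, hR⟩ := connects_append.1 h.connects
  obtain ⟨m', hL', rfl, hm'⟩ := connects_append.1 hL
  obtain rfl : s.snd = m := hm'
  have hnd := h.nodup
  have hpr := h.proper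
  rw [List.map_append] at hnd hbase
  rw [List.nodup_append'] at hnd
  obtain ⟨hA₁, hR₁, hAR⟩ := hnd
  have hzR : z ∈ R.map PathSegment.snd := by
    rcases List.mem_cons.1 hR.end_mem with h' | h'
    · exact absurd h' hne
    · exact h'
  have hsA : s.snd ∈ A.map PathSegment.snd := List.mem_map_of_mem (by simp [hA])
  have hvert := vertices_revPath hR
  refine ⟨A, revPath R, ?_, hL, hR.revPath, List.nodup_cons.2 ⟨fun h' => hAR h' hzR, hA₁⟩, ?_, ?_,
    ?_⟩
  -- If the arcs coincided, s would be the reverse of a segment of R, against properness of the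
  -- closed path.
  · intro heq
    have hs' : s ∈ revPath R := by rw [← heq]; simp [hA]
    obtain ⟨t, ht, rfl⟩ : ∃ t ∈ R, t.rev = s := by simpa [revPath] using hs'
    rw [IsProper, List.pairwise_append] at hpr
    exact hpr.2.2 _ (by simp [hA]) t ht (weaklyEqual_iff_key_eq.2 t.key_rev)
  · rw [hvert, List.nodup_reverse]
    exact List.nodup_cons.2 ⟨fun h' => hAR hsA h', hR₁⟩
  · intro e he
    rw [List.map_append]
    exact List.mem_append_left _ he
  · intro e he
    have : e ∈ (s.snd :: R.map PathSegment.snd) := by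
      rw [← List.mem_reverse, ← hvert]
      exact List.mem_cons_of_mem _ he
    rw [List.map_append]
    rcases List.mem_cons.1 this with rfl | h'
    · exact List.mem_append_left _ hsA
    · exact List.mem_append_right _ h'

end IsSimpleClosed

/-- The uniqueness of inner-cycle free proper paths between affected minimal elements excludes
simple closed paths. -/
theorem not_isSimpleClosed [Finite I] (hI : NoDirectedCycles I) (hD : ImageDisjoint D)
    (hu : ∀ z z' : Elem D X, IsAffected z.1 → IsAffected z'.1 →
      ∀ P P' : List (PathSegment D X), Connects P z z' → IsProper P → IsInnerCycleFree P →
        Connects P' z z' → IsProper P' → IsInnerCycleFree P' → P = P')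
    (z : Elem D X) : ∀ P : List (PathSegment D X), ¬ IsSimpleClosed P z := by
  -- Well-founded induction towards predecessors: if the closed path leaves z against an edge, or
  -- returns to z along an edge, the base can be rotated to a predecessor. What remains is a top
  -- vertex, left by an edge d and reached again by some d'^op.
  induction z using (hI.wellFounded_step (D := D) (X := X)).induction with
  | _ z ih =>
  intro P h
  obtain ⟨s, P₁, rfl⟩ := List.exists_cons_of_ne_nil h.ne_nil
  obtain ⟨i, j, d, y, rfl⟩ | ⟨i, j, d, y, rfl⟩ := s.eq_forward_or_backward
  swap
  · obtain ⟨rfl, hP₁⟩ := h.connects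
    exact ih ⟨i, y⟩ (step_edgeMap d y) _
      (h.rotate (P := [PathSegment.backward d y]) (connects_singleton _) hP₁)
  obtain rfl : z = ⟨i, y⟩ := h.connects.1.symm
  obtain ⟨P₂, t, ht⟩ : ∃ P₂ t, PathSegment.forward d y :: P₁ = P₂ ++ [t] :=
    (List.eq_nil_or_concat' _).resolve_left h.ne_nil
  have hts : t.snd = ⟨i, y⟩ := by
    have := h.connects
    rw [ht] at this
    obtain ⟨m, -, -, hm⟩ := connects_append.1 this
    exact hm
  have htm : t ∈ PathSegment.forward d y :: P₁ := by rw [ht]; simp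
  obtain ⟨i', j', d', y', rfl⟩ | ⟨i', j', d', y', rfl⟩ := t.eq_forward_or_backward
  · have h' := h
    rw [ht] at h'
    obtain ⟨m, hm, rfl, hm'⟩ := connects_append.1 h'.connects
    refine ih ⟨i', y'⟩ ?_ _ (h'.rotate hm ⟨rfl, hm'⟩)
    rw [← hts]
    exact step_edgeMap d' y'
  cases hts
  -- With d = d' the first and the last segment would share their key; properness would make them
  -- equal, but their orientations differ.
  have hdd : (⟨j, d⟩ : Σ k : I, i ⟶ k) ≠ ⟨j', d'⟩ := by
    intro heq
    have hk : (PathSegment.forward d y).key = (PathSegment.backward d' y).key := by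
      cases heq
      rfl
    have := List.inj_on_of_nodup_map (isProper_iff_nodup.1 h.proper) List.mem_cons_self htm hk
    exact Sum.inl_ne_inr (congrArg PathSegment.edge this)
  set P := PathSegment.forward d y :: P₁ with hP
  have hstart : (⟨j, edgeMap D X d y⟩ : Elem D X) ∈ P.map PathSegment.snd :=
    List.mem_map_of_mem (f := PathSegment.snd) (a := PathSegment.forward d y) List.mem_cons_self
  have hend : (⟨j', edgeMap D X d' y⟩ : Elem D X) ∈ P.map PathSegment.snd := h.fst_mem htm
  -- Taking the last vertices c and c' of the closed path below each side ensures that the descents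
  -- from them never meet the closed path again.
  obtain ⟨c, hc, hjc, hexit⟩ := exists_last_exit hI (· ∈ P.map PathSegment.snd) _ hstart
  obtain ⟨c', hc', hjc', hexit'⟩ := exists_last_exit hI (· ∈ P.map PathSegment.snd) _ hend
  obtain ⟨m, R, hm, hcm, hR, hRlt, hRnd⟩ := exists_descent hI c
  obtain ⟨m', R', hm', hcm', hR', hRlt', hRnd'⟩ := exists_descent hI c'
  have hdisj : ∀ {e e'}, Relation.ReflTransGen Step c e → Relation.ReflTransGen Step c' e' →
      e ≠ e' := by
    rintro e _ h₁ h₂ rfl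
    exact hD.not_reach hI hdd y (hjc.trans h₁) (hjc'.trans h₂)
  have hbr : IsBranching i := ⟨_, _, hdd⟩
  have haff : IsAffected m.1 :=
    ⟨hm, i, hbr, ⟨d.toPath.comp (exists_pathMap_eq (hjc.trans hcm)).choose⟩⟩
  have haff' : IsAffected m'.1 :=
    ⟨hm', i, hbr, ⟨d'.toPath.comp (exists_pathMap_eq (hjc'.trans hcm')).choose⟩⟩
  obtain ⟨Q, hQ, hQP⟩ := h.exists_rotate hc
  obtain ⟨A, C, hAC, hA, hC, hAnd, hCnd, hAP, hCP⟩ :=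
    hQ.exists_arcs ((hQP c').2 hc') (hdisj .refl .refl)
  -- The concatenation descends in reverse from m to c, follows an arc to c', and descends to m'.
  -- Its three pieces are disjoint by the choice of c and c' and by `hdisj`.
  have key : ∀ A : List (PathSegment D X), Connects A c c' →
      (c :: A.map PathSegment.snd).Nodup →
      (∀ e ∈ A.map PathSegment.snd, e ∈ Q.map PathSegment.snd) →
      Connects (revPath R ++ (A ++ R')) m m' ∧
        (m :: (revPath R ++ (A ++ R')).map PathSegment.snd).Nodup := by
    intro A hA hAnd hAP
    refine ⟨hR.revPath.append (hA.append hR'), ?_⟩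
    rw [List.map_append, ← List.cons_append, vertices_revPath hR, List.map_append,
      List.nodup_append', List.nodup_append', List.nodup_reverse]
    have hmem : ∀ {e}, e ∈ A.map PathSegment.snd → e ∈ P.map PathSegment.snd :=
      fun he => (hQP _).1 (hAP _ he)
    refine ⟨hRnd, ⟨(List.nodup_cons.1 hAnd).2, (List.nodup_cons.1 hRnd').2,
      fun e he he' => hexit' e (hRlt' e he') (hmem he)⟩, fun e he he' => ?_⟩
    rw [List.mem_reverse] at he
    rcases List.mem_append.1 he' with he' | he'
    · rcases List.mem_cons.1 he with rfl | he
      · exact (List.nodup_cons.1 hAnd).1 he'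
      · exact hexit e (hRlt e he) (hmem he')
    · refine hdisj ?_ (hRlt' e he').to_reflTransGen rfl
      rcases List.mem_cons.1 he with rfl | he
      · exact .refl
      · exact (hRlt e he).to_reflTransGen
  obtain ⟨kA, kA'⟩ := key A hA hAnd hAP
  obtain ⟨kC, kC'⟩ := key C hC hCnd hCP
  have := hu m m' haff haff' _ _ kA (isProper_of_nodup kA kA') (isInnerCycleFree_of_nodup kA kA')
    kC (isProper_of_nodup kC kC') (isInnerCycleFree_of_nodup kC kC')
  exact hAC (List.append_cancel_right (List.append_cancel_left this))

end SimpleClosed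

end GraphVK
-- Double coverings twisted along one edge, and parity.
namespace GraphVK

open Diagram

section Elementwise

variable {B : Type u} [Category.{v} B]

theorem isPullback_of_elements {F₁ F₂ F₃ F₄ : B ⥤ Type w} {t : F₁ ⟶ F₂} {l : F₁ ⟶ F₃}
    {r : F₂ ⟶ F₄} {b : F₃ ⟶ F₄} (w : t ≫ r = l ≫ b)
    (h₁ : ∀ (Y : B) (x x' : F₁.obj Y), t.app Y x = t.app Y x' → l.app Y x = l.app Y x' → x = x')
    (h₂ : ∀ (Y : B) (x₂ : F₂.obj Y) (x₃ : F₃.obj Y), r.app Y x₂ = b.app Y x₃ →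
      ∃ x, t.app Y x = x₂ ∧ l.app Y x = x₃) : IsPullback t l r b := by
  refine IsPullback.of_forall_isPullback_app fun Y => ?_
  exact (Types.isPullback_iff _ _ _ _).2 ⟨by rw [← NatTrans.comp_app, w, NatTrans.comp_app],
    fun x x' h => h₁ Y x x' h.1 h.2, h₂ Y⟩

end Elementwise

section Twist

variable {I : Type u₁} [Quiver.{v₁} I] {B : Type u} [SmallCategory B]
  (D : Diagram I (B ⥤ Type u)) (X : B) (k : Quiver.Total I × Elem D X)

variable {D X} in
open Classical in
/-- The characteristic function of an undirected edge of the graph of elements. -/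
noncomputable def keyBit (a : Quiver.Total I × Elem D X) : Bool := decide (a = k)

variable {D X} in
theorem keyBit_self : keyBit k k = true := by simp [keyBit]

variable {D X} in
theorem keyBit_of_ne {a : Quiver.Total I × Elem D X} (h : a ≠ k) : keyBit k a = false := by
  simpa [keyBit] using h

/-- The double covering of `D` that is twisted along one undirected edge of the graph of elements
of sort `X`, coinduced to all sorts. -/
noncomputable def twist : Diagram I (B ⥤ Type u) where
  obj i :=
    { obj := fun Y => (D.obj i).obj Y × ((Y ⟶ X) → Bool)
      map := fun g => ↾fun p => ((D.obj i).map g p.1, fun f => p.2 (g ≫ f)) }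
  map {i j} d :=
    { app := fun Y => ↾fun p => ((D.map d).app Y p.1,
        fun f => xor (p.2 f) (keyBit k (⟨i, j, d⟩, ⟨i, (D.obj i).map f p.1⟩)))
      naturality := fun Y Z g => by
        ext p <;> simp }

/-- The projection of the twisted double covering. -/
noncomputable def twistHom : twist D X k ⟶ D where
  app i := { app := fun Y => ↾fun p => p.1 }
  naturality d := rfl

variable {D X} in
theorem twist_map_app {i j : I} (d : i ⟶ j) {Y : B} (y : (D.obj i).obj Y) (φ : (Y ⟶ X) → Bool) :
    ((twist D X k).map d).app Y (y, φ) = ((D.map d).app Y y,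
      fun f => xor (φ f) (keyBit k (⟨i, j, d⟩, ⟨i, (D.obj i).map f y⟩))) := rfl

variable {D X} in
theorem twist_map_app_untwist {i j : I} (d : i ⟶ j) {Y : B} (y : (D.obj i).obj Y)
    (φ : (Y ⟶ X) → Bool) : ((twist D X k).map d).app Y
      (y, fun f => xor (φ f) (keyBit k (⟨i, j, d⟩, ⟨i, (D.obj i).map f y⟩))) =
        ((D.map d).app Y y, φ) := by
  rw [twist_map_app]
  exact congrArg (Prod.mk _)
    (funext fun f => by rw [Bool.xor_assoc, Bool.xor_self, Bool.xor_false])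

/-- Over a fixed y an edge acts on the fibre by xor with a fixed family. This is an involution, so
every naturality square is bijective on fibres. -/
theorem twistHom_isCartesian : IsCartesian (twistHom D X k) := by
  intro i j d
  refine isPullback_of_elements ((twistHom D X k).naturality d) ?_ ?_
  · rintro Y ⟨y, φ⟩ ⟨y', φ'⟩ h₁ h₂
    obtain rfl : y = y' := h₂
    refine Prod.ext rfl (funext fun f => ?_)
    have := congrFun (Prod.ext_iff.1 h₁).2 f
    simpa using show xor (φ f) _ = xor (φ' f) _ from this
  · rintro Y ⟨y', φ⟩ y rfl
    exact ⟨_, twist_map_app_untwist k d y φ, rfl⟩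

variable {D X}

/-- The parity of the number of times a mapping path traverses a given undirected edge. -/
noncomputable def parity (P : List (PathSegment D X)) : Bool :=
  P.foldr (fun s b => xor (keyBit k s.key) b) false

@[simp] theorem parity_nil : parity k ([] : List (PathSegment D X)) = false := rfl

theorem parity_cons (s : PathSegment D X) (P : List (PathSegment D X)) :
    parity k (s :: P) = xor (keyBit k s.key) (parity k P) := rfl

theorem parity_eq_false {P : List (PathSegment D X)} (h : k ∉ P.map PathSegment.key) :
    parity k P = false := by
  induction P with
  | nil => rfl
  | cons s P ih =>
    rw [List.map_cons, List.mem_cons, not_or] at h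
    rw [parity_cons, ih h.2, keyBit_of_ne k (Ne.symm h.1), Bool.xor_false]

theorem parity_cons_of_isProper {s : PathSegment D X} {P : List (PathSegment D X)}
    (h : IsProper (s :: P)) : parity s.key (s :: P) = true := by
  rw [isProper_iff_nodup, List.map_cons, List.nodup_cons] at h
  rw [parity_cons, parity_eq_false _ h.1, keyBit_self, Bool.xor_false]

/-- A cocone is constant along the lift of a path to the covering. Only the coordinate at `𝟙 X`
matters: there the twist tests the traversed edge itself. Forward and backward segments change it by
the same bit, since xor is its own inverse. -/
theorem exists_transport_twist {K : B ⥤ Type u}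
    (ρ : twist D X k ⟶ (const I (B ⥤ Type u)).obj K)
    {P : List (PathSegment D X)} {z z' : Elem D X} (h : Connects P z z') (φ : (X ⟶ X) → Bool) :
    ∃ φ' : (X ⟶ X) → Bool,
      (leg ρ z'.1).app X (z'.2, φ') = (leg ρ z.1).app X (z.2, φ) ∧
      φ' (𝟙 X) = xor (φ (𝟙 X)) (parity k P) := by
  have hρ : ∀ {i j : I} (d : i ⟶ j) (p : ((twist D X k).obj i).obj X),
      (leg ρ j).app X (((twist D X k).map d).app X p) = (leg ρ i).app X p := fun d p => by
    rw [← leg_w ρ d]; rfl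
  induction P generalizing z φ with
  | nil =>
    obtain rfl : z = z' := h
    exact ⟨φ, rfl, by simp⟩
  | cons s P ih =>
    obtain ⟨rfl, h⟩ := h
    obtain ⟨i, j, d, y, rfl⟩ | ⟨i, j, d, y, rfl⟩ := s.eq_forward_or_backward <;>
    obtain ⟨φ', h₁, h₂⟩ := ih h
        (fun f => xor (φ f) (keyBit k (⟨i, j, d⟩, ⟨i, (D.obj i).map f y⟩))) <;>
    refine ⟨φ', h₁.trans ?_, ?_⟩
    · exact hρ d (y, φ)
    · rw [h₂, parity_cons, ← Bool.xor_assoc]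
      simp [PathSegment.key, PathSegment.forward]
    · exact (hρ d _).symm.trans (congrArg ((leg ρ j).app X) (twist_map_app_untwist k d y φ))
    · rw [h₂, parity_cons, ← Bool.xor_assoc]
      simp [PathSegment.key, PathSegment.backward]

end Twist

/-! ### The Van Kampen property forces uniqueness of proper paths. -/

section VanKampen

variable {I : Type u₁} [Quiver.{v₁} I] {B : Type u} [SmallCategory B]
  {D : Diagram I (B ⥤ Type u)} {S : B ⥤ Type u} {κ : D ⟶ (const I (B ⥤ Type u)).obj S}

/-- The projections of the pullbacks of `σ` onto its domain, as a cocone. -/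
noncomputable def pullbackProj (κ : D ⟶ (const I (B ⥤ Type u)).obj S) (σ : Over S) :
    pullbackDiagram κ σ ⟶ (const I (B ⥤ Type u)).obj σ.left where
  app i := pullback.snd (leg κ i) σ.hom
  naturality d := pullbackEdge_snd κ σ d

theorem pullbackDiagram_ext {σ : Over S} {i : I} {Y : B}
    {x x' : ((pullbackDiagram κ σ).obj i).obj Y}
    (h₁ : (Hom.app (pullbackHom κ σ) i).app Y x = (Hom.app (pullbackHom κ σ) i).app Y x')
    (h₂ : (leg (pullbackProj κ σ) i).app Y x = (leg (pullbackProj κ σ) i).app Y x') : x = x' :=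
  Types.ext_of_isPullback ((IsPullback.of_hasPullback (leg κ i) σ.hom).app Y) h₁ h₂

theorem exists_pullbackDiagram {σ : Over S} {i : I} {Y : B} (y : (D.obj i).obj Y)
    (c : σ.left.obj Y) (h : (leg κ i).app Y y = σ.hom.app Y c) :
    ∃ x : ((pullbackDiagram κ σ).obj i).obj Y, (Hom.app (pullbackHom κ σ) i).app Y x = y ∧
      (leg (pullbackProj κ σ) i).app Y x = c :=
  Types.exists_of_isPullback ((IsPullback.of_hasPullback (leg κ i) σ.hom).app Y) y c h

/-- Under the Van Kampen property, every cartesian transformation has a cocone that separates the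
elements of each fibre. -/
theorem exists_separating_cocone (hκ : IsVanKampen κ) {E : Diagram I (B ⥤ Type u)}
    (τ : E ⟶ D) (hτ : IsCartesian τ) :
    ∃ (K : B ⥤ Type u) (ρ : E ⟶ (const I (B ⥤ Type u)).obj K),
      ∀ (i : I) (Y : B) (x x' : (E.obj i).obj Y), (Hom.app τ i).app Y x = (Hom.app τ i).app Y x' →
        (leg ρ i).app Y x = (leg ρ i).app Y x' → x = x' := by
  have : (pullbackFunctor κ).IsEquivalence := hκ
  let F : CartesianOver D := ⟨Over.mk τ, hτ⟩
  let Φ := (pullbackFunctor κ).objObjPreimageIso F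
  -- By essential surjectivity τ is, up to isomorphism, the pullback of some σ; an element of a
  -- pullback is determined by its two projections.
  set σ := (pullbackFunctor κ).objPreimage F
  let α : E ⟶ pullbackDiagram κ σ := Φ.inv.hom.left
  let β : pullbackDiagram κ σ ⟶ E := Φ.hom.hom.left
  have hα : α ≫ pullbackHom κ σ = τ := Over.w Φ.inv.hom
  have hαβ : α ≫ β = 𝟙 E :=
    congrArg (fun f : F ⟶ F => f.hom.left) Φ.inv_hom_id
  refine ⟨σ.left, α ≫ pullbackProj κ σ, fun i Y x x' h₁ h₂ => ?_⟩
  have hx : (Hom.app α i).app Y x = (Hom.app α i).app Y x' := by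
    rw [← hα] at h₁
    exact pullbackDiagram_ext h₁ h₂
  have hinv : ∀ x, (Hom.app β i).app Y ((Hom.app α i).app Y x) = x := fun x => by
    have := congrArg (fun f : E ⟶ E => (Hom.app f i).app Y x) hαβ
    simpa using this
  rw [← hinv x, hx, hinv]

/-- Transporting the zero element of the fibre over z along both paths gives two elements of the
same fibre over z' with the same value under the cocone. They are equal by separation, and their
coordinates at `𝟙 X` are the two parities. -/
theorem parity_eq_of_isVanKampen (hκ : IsVanKampen κ) {X : B} {P P' : List (PathSegment D X)}
    {z z' : Elem D X} (hP : Connects P z z') (hP' : Connects P' z z')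
    (k : Quiver.Total I × Elem D X) : parity k P = parity k P' := by
  obtain ⟨K, ρ, hinj⟩ := exists_separating_cocone hκ _ (twistHom_isCartesian D X k)
  obtain ⟨φ, h₁, h₂⟩ := exists_transport_twist k ρ hP fun _ => false
  obtain ⟨φ', h₁', h₂'⟩ := exists_transport_twist k ρ hP' fun _ => false
  have := hinj z'.1 X (z'.2, φ) (z'.2, φ') rfl (h₁.trans h₁'.symm)
  rw [show φ = φ' from (Prod.ext_iff.1 this).2, h₂'] at h₂
  simpa using h₂.symm

theorem eq_nil_of_isVanKampen (hκ : IsVanKampen κ) {X : B} {P : List (PathSegment D X)}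
    {z : Elem D X} (hP : Connects P z z) (hp : IsProper P) : P = [] := by
  cases P with
  | nil => rfl
  | cons s P =>
    have := parity_eq_of_isVanKampen hκ hP (P' := []) rfl s.key
    rw [parity_cons_of_isProper hp] at this
    exact absurd this (by simp)

/-- In the presence of the Van Kampen property, proper mapping paths are unique. -/
theorem path_unique_of_isVanKampen (hκ : IsVanKampen κ) {X : B} {P P' : List (PathSegment D X)}
    {z z' : Elem D X} (hP : Connects P z z') (hp : IsProper P) (hP' : Connects P' z z')
    (hp' : IsProper P') : P = P' := by
  induction P generalizing z P' with
  | nil =>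
    obtain rfl : z = z' := hP
    exact (eq_nil_of_isVanKampen hκ hP' hp').symm
  | cons s P ih =>
    -- The path `s :: P` crosses the edge of s exactly once, so P' must cross it too.
    have hs : s.key ∈ P'.map PathSegment.key := by
      by_contra h
      have := parity_eq_of_isVanKampen hκ hP hP' s.key
      rw [parity_cons_of_isProper hp, parity_eq_false _ h] at this
      exact absurd this (by simp)
    obtain ⟨t, ht, hts⟩ := List.mem_map.1 hs
    obtain ⟨L, R, rfl⟩ := List.append_of_mem ht
    obtain ⟨m, hL, rfl, hR⟩ := connects_append.1 hP'
    rw [IsProper, List.pairwise_append] at hp'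
    -- If P' crosses in the same direction, the part L before the crossing is a closed proper path,
    -- hence empty. If it crosses in the opposite direction, `L ++ [t]` is a nonempty closed proper
    -- path, which is impossible.
    rcases weaklyEqual_iff_key_eq.2 hts with rfl | ⟨-, -, h⟩
    · obtain rfl : L = [] := eq_nil_of_isVanKampen hκ (hP.1 ▸ hL) hp'.1
      rw [ih hP.2 (List.pairwise_cons.1 hp).2 hR (List.pairwise_cons.1 hp'.2.1).2]
      rfl
    · have hLt : Connects (L ++ [t]) z z := hL.append ⟨rfl, h.trans hP.1⟩
      have := eq_nil_of_isVanKampen hκ hLt (List.pairwise_append.2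
        ⟨hp'.1, List.pairwise_singleton _ _, fun a ha b hb =>
          hp'.2.2 a ha b (List.mem_singleton.1 hb ▸ List.mem_cons_self)⟩)
      simp at this

end VanKampen

end GraphVK
-- Lifting paths along cartesian transformations, and monodromy.
namespace GraphVK

open Diagram

section Cocones

variable {I : Type u₁} [Quiver.{v₁} I] {B : Type u} [Category.{v} B]
  {D : Diagram I (B ⥤ Type w)} {X : B}

theorem leg_eq_of_connects {T : B ⥤ Type w} (ρ : D ⟶ (const I (B ⥤ Type w)).obj T)
    {P : List (PathSegment D X)} {z z' : Elem D X} (h : Connects P z z') :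
    (leg ρ z.1).app X z.2 = (leg ρ z'.1).app X z'.2 := by
  have hρ : ∀ {i j : I} (d : i ⟶ j) (y : (D.obj i).obj X),
      (leg ρ j).app X (edgeMap D X d y) = (leg ρ i).app X y := fun d y => by
    rw [← leg_w ρ d]; rfl
  induction P generalizing z with
  | nil => rw [show z = z' from h]
  | cons s P ih =>
    obtain ⟨rfl, h⟩ := h
    rw [← ih h]
    obtain ⟨i, j, d, y, rfl⟩ | ⟨i, j, d, y, rfl⟩ := s.eq_forward_or_backward
    · exact (hρ d y).symm
    · exact hρ d y

theorem connects_forward {i j : I} (d : i ⟶ j) (y : (D.obj i).obj X) :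
    Connects [PathSegment.forward d y] ⟨i, y⟩ ⟨j, edgeMap D X d y⟩ := ⟨rfl, rfl⟩

theorem connects_backward {i j : I} (d : i ⟶ j) (y : (D.obj i).obj X) :
    Connects [PathSegment.backward d y] ⟨j, edgeMap D X d y⟩ ⟨i, y⟩ := ⟨rfl, rfl⟩

/-- The map on elements induced by a natural transformation of diagrams. -/
def elemMap {E D : Diagram I (B ⥤ Type w)} (τ : E ⟶ D) (e : Elem E X) : Elem D X :=
  ⟨e.1, (Hom.app τ e.1).app X e.2⟩

theorem edgeMap_naturality {E D : Diagram I (B ⥤ Type w)} (τ : E ⟶ D) {i j : I} (d : i ⟶ j)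
    (x : (E.obj i).obj X) : (Hom.app τ j).app X (edgeMap E X d x) =
      edgeMap D X d ((Hom.app τ i).app X x) :=
  congrArg (fun f : E.obj i ⟶ D.obj j => f.app X x) (Hom.naturality τ d)

variable {E : Diagram I (B ⥤ Type w)} {τ : E ⟶ D}

/-- Mapping paths lift along cartesian transformations. -/
theorem exists_lift (hτ : IsCartesian τ) {P : List (PathSegment D X)} {z z' : Elem D X}
    (h : Connects P z z') (e : Elem E X) (he : elemMap τ e = z) :
    ∃ (e' : Elem E X) (Q : List (PathSegment E X)), Connects Q e e' ∧ elemMap τ e' = z' := by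
  induction P generalizing z e with
  | nil => exact ⟨e, [], rfl, he.trans h⟩
  | cons s P ih =>
    obtain ⟨rfl, h⟩ := h
    obtain ⟨i, x⟩ := e
    obtain ⟨i', j, d, y, rfl⟩ | ⟨i', j, d, y, rfl⟩ := s.eq_forward_or_backward
    · cases he
      obtain ⟨e', Q, hQ, he'⟩ := ih h ⟨j, edgeMap E X d x⟩
        (Sigma.ext rfl (heq_of_eq (edgeMap_naturality τ d x)))
      exact ⟨e', _, (connects_forward d x).append hQ, he'⟩
    · obtain rfl : i = j := congrArg Sigma.fst he
      have hx : (Hom.app τ i).app X x = edgeMap D X d y := eq_of_heq (Sigma.ext_iff.1 he).2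
      -- Only a segment traversed against its edge needs the pullback property; forward segments
      -- lift along any natural transformation.
      obtain ⟨x', rfl, rfl⟩ := Types.exists_of_isPullback ((hτ d).app X) x y hx
      obtain ⟨e', Q, hQ, he'⟩ := ih h ⟨i', x'⟩ rfl
      exact ⟨e', _, (connects_backward d x').append hQ, he'⟩

/-- The image of a path segment under a natural transformation. -/
def PathSegment.map (τ : E ⟶ D) (s : PathSegment E X) : PathSegment D X where
  fst := elemMap τ s.fst
  edge := s.edge
  snd := elemMap τ s.snd
  valid := by
    obtain ⟨i, j, d, y, rfl⟩ | ⟨i, j, d, y, rfl⟩ := s.eq_forward_or_backward <;>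
      exact ⟨_, rfl, Sigma.ext rfl (heq_of_eq (edgeMap_naturality τ d y))⟩

theorem Connects.map {P : List (PathSegment E X)} {e e' : Elem E X} (h : Connects P e e') :
    Connects (P.map (PathSegment.map τ)) (elemMap τ e) (elemMap τ e') := by
  induction P generalizing e with
  | nil => exact congrArg _ h
  | cons s P ih => exact ⟨congrArg (elemMap τ) h.1, ih h.2⟩

/-- A segment of a cartesian transformation is determined by its image and its end. -/
theorem fst_eq_snd_of_backtrack (hτ : IsCartesian τ) {s t : PathSegment E X}
    (h₁ : elemMap τ s.fst = elemMap τ t.snd) (h₂ : s.edge = t.edge.swap) (h₃ : s.snd = t.fst) :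
    s.fst = t.snd := by
  obtain ⟨i, j, d, y, rfl⟩ | ⟨i, j, d, y, rfl⟩ := s.eq_forward_or_backward <;>
  obtain ⟨i', j', d', y', rfl⟩ | ⟨i', j', d', y', rfl⟩ := t.eq_forward_or_backward <;>
  simp only [PathSegment.forward, PathSegment.backward, Sum.swap_inl, Sum.swap_inr,
    reduceCtorEq, Sum.inl.injEq, Sum.inr.injEq] at h₁ h₂ h₃ ⊢
  · cases h₂
    have h₁ := eq_of_heq (Sigma.ext_iff.1 h₁).2
    have h₃ := eq_of_heq (Sigma.ext_iff.1 h₃).2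
    rw [Types.ext_of_isPullback ((hτ d).app X) h₃ h₁]
  · cases h₂
    cases h₃
    rfl

theorem exists_split_of_not_pairwise {α : Type*} {R : α → α → Prop} {l : List α}
    (h : ¬ l.Pairwise R) : ∃ l₁ a l₂ b l₃, l = l₁ ++ a :: (l₂ ++ b :: l₃) ∧ ¬ R a b := by
  induction l with
  | nil => exact absurd List.Pairwise.nil h
  | cons c l ih =>
    rw [List.pairwise_cons, not_and_or] at h
    rcases h with h | h
    · push Not at h
      obtain ⟨b, hb, hR⟩ := h
      obtain ⟨l₂, l₃, rfl⟩ := List.append_of_mem hb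
      exact ⟨[], c, l₂, b, l₃, rfl, hR⟩
    · obtain ⟨l₁, a, l₂, b, l₃, rfl, hR⟩ := ih h
      exact ⟨c :: l₁, a, l₂, b, l₃, rfl, hR⟩

/-- In the absence of simple closed paths the fibres of a cartesian transformation have trivial
monodromy. -/
theorem eq_of_connects_of_elemMap_eq (hτ : IsCartesian τ)
    (hsc : ∀ (z : Elem D X) (P : List (PathSegment D X)), ¬ IsSimpleClosed P z)
    (Q : List (PathSegment E X)) {e e' : Elem E X} (hQ : Connects Q e e')
    (he : elemMap τ e = elemMap τ e') : e = e' := by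
  -- A shortest walk with different ends in one fibre projects to a simple closed path, since any
  -- repetition downstairs can be cut out upstairs.
  induction hn : Q.length using Nat.strong_induction_on generalizing Q e e' with
  | _ n ih =>
  subst hn
  by_contra hne
  -- The walk between two vertices with the same image is shorter, hence closed by induction;
  -- removing it leaves a shorter walk with the same ends as Q.
  have hsnd : ∀ Q₁ s Q₂ t Q₃, Q = Q₁ ++ s :: (Q₂ ++ t :: Q₃) →
      elemMap τ s.snd ≠ elemMap τ t.snd := by
    rintro Q₁ s Q₂ t Q₃ rfl hst
    obtain ⟨a, h₁, rfl, h⟩ := connects_append.1 hQ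
    obtain ⟨b, h₂, rfl, h₃⟩ := connects_append.1 h
    have hst' := ih (Q₂ ++ [t]).length (by simp; omega) _ (h₂.append (connects_singleton t)) hst rfl
    have h₄ : Connects (s :: Q₃) s.fst e' := ⟨rfl, by rwa [hst']⟩
    exact hne (ih (Q₁ ++ s :: Q₃).length (by simp) _ (h₁.append h₄) he rfl)
  refine hsc (elemMap τ e) (Q.map (PathSegment.map τ)) ⟨?_, ?_, ?_, ?_⟩
  · intro h
    rw [List.map_eq_nil_iff] at h
    subst h
    exact hne hQ
  · have := hQ.map (τ := τ)
    rwa [← he] at this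
  · by_contra h
    rw [IsProper, List.pairwise_map] at h
    obtain ⟨Q₁, s, Q₂, t, Q₃, heq, hst⟩ := exists_split_of_not_pairwise h
    rcases not_not.1 hst with hst | ⟨h₁, h₂, h₃⟩
    · exact hsnd Q₁ s Q₂ t Q₃ heq (congrArg PathSegment.snd hst)
    · subst heq
      obtain ⟨a, k₁, rfl, k⟩ := connects_append.1 hQ
      obtain ⟨b, k₂, rfl, k₃⟩ := connects_append.1 k
      -- In the backtracking case the walk Q₂ between the two segments is closed by induction. Both
      -- segments then lift the same edge at the same element, so s, Q₂ and t can be removed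
      -- together.
      have hst' := ih Q₂.length (by simp; omega) _ k₂ h₃ rfl
      have hst'' := fst_eq_snd_of_backtrack hτ h₁ h₂ hst'
      refine hne (ih (Q₁ ++ Q₃).length (by simp; omega) _ (k₁.append ?_) he rfl)
      rwa [hst'']
  · by_contra h
    rw [List.map_map, List.Nodup, List.pairwise_map] at h
    obtain ⟨Q₁, s, Q₂, t, Q₃, heq, hst⟩ := exists_split_of_not_pairwise h
    exact hsnd Q₁ s Q₂ t Q₃ heq (not_not.1 hst)

end Cocones

/-! ### Colimits of presheaves, elementwise -/

section Colimit

variable {I : Type u₁} [Quiver.{v₁} I] {B : Type u} [SmallCategory B]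
  {D : Diagram I (B ⥤ Type u)} {S : B ⥤ Type u} {κ : D ⟶ (const I (B ⥤ Type u)).obj S}

/-- The presheaf of families of truth values indexed by the morphisms into `X`. -/
def truthFamilies (X : B) : B ⥤ Type u where
  obj Y := (Y ⟶ X) → Prop
  map g := ↾fun φ f => φ (g ≫ f)

/-- The cocone classifying a set of elements that is closed under the edges of the graph of
elements. -/
def classifier {X : B} (A : Elem D X → Prop)
    (hA : ∀ {i j : I} (d : i ⟶ j) (y : (D.obj i).obj X), A ⟨j, edgeMap D X d y⟩ ↔ A ⟨i, y⟩) :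
    D ⟶ (const I (B ⥤ Type u)).obj (truthFamilies X) where
  app i :=
    { app := fun Y => ↾fun y f => A ⟨i, (D.obj i).map f y⟩
      naturality := fun Y Z g => by
        ext y
        refine funext fun f => congrArg (fun y' => A ⟨i, y'⟩) ?_
        exact (ConcreteCategory.congr_hom ((D.obj i).map_comp g f) y).symm }
  naturality {i j} d := by
    refine NatTrans.ext (funext fun Y => ?_)
    ext y
    refine funext fun f => propext ?_
    refine Iff.trans (Iff.of_eq ?_) (hA d ((D.obj i).map f y))
    exact congrArg (fun y' => A ⟨j, y'⟩) (NatTrans.naturality_apply (D.map d) f y).symm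

/-- The constantly true predicate on S and the predicate of lying in the image of κ agree after
composition with κ, so the uniqueness of factorizations identifies them. -/
theorem exists_leg_eq_of_isColimiting (hκ : IsColimiting κ) {X : B} (s : S.obj X) :
    ∃ (i : I) (y : (D.obj i).obj X), (leg κ i).app X y = s := by
  let ρ := classifier (D := D) (X := X) (fun _ => True) (fun _ _ => Iff.rfl)
  let t₁ : S ⟶ truthFamilies X := { app := fun Y => ↾fun s f => True }
  let t₂ : S ⟶ truthFamilies X :=
    { app := fun Y => ↾fun s f => ∃ (i : I) (y : (D.obj i).obj X), (leg κ i).app X y = S.map f s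
      naturality := fun Y Z g => by
        ext s
        exact funext fun f => by simp [truthFamilies] }
  have h₁ : κ ≫ (const I (B ⥤ Type u)).map t₁ = ρ := rfl
  have h₂ : κ ≫ (const I (B ⥤ Type u)).map t₂ = ρ := by
    refine hom_ext fun i => NatTrans.ext (funext fun Y => ?_)
    ext y
    refine funext fun f => propext ⟨fun _ => trivial, fun _ => ?_⟩
    exact ⟨i, (D.obj i).map f y, NatTrans.naturality_apply (leg κ i) f y⟩
  have h := (hκ _ ρ).unique h₁ h₂
  have : True = ∃ (i : I) (y : (D.obj i).obj X), (leg κ i).app X y = S.map (𝟙 X) s :=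
    congrArg (fun t : S ⟶ truthFamilies X => t.app X s (𝟙 X)) h
  simpa using this.mp trivial

/-- The predicate of being connected to z is invariant under edges, so its classifier factors
through S and takes equal values on elements with equal image. Evaluating at `𝟙 X` recovers the
predicate. -/
theorem exists_connects_of_isColimiting (hκ : IsColimiting κ) {X : B} {z z' : Elem D X}
    (h : (leg κ z.1).app X z.2 = (leg κ z'.1).app X z'.2) : ∃ P, Connects P z z' := by
  let ρ := classifier (D := D) (X := X) (fun e => ∃ P, Connects P z e) (fun d y =>
    ⟨fun ⟨P, hP⟩ => ⟨_, hP.append (connects_backward d y)⟩,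
      fun ⟨P, hP⟩ => ⟨_, hP.append (connects_forward d y)⟩⟩)
  obtain ⟨t, ht, -⟩ := hκ _ ρ
  have key : ∀ e : Elem D X,
      t.app X ((leg κ e.1).app X e.2) (𝟙 X) = ∃ P, Connects P z e := fun e => by
    have := congrArg (fun f : D ⟶ (const I (B ⥤ Type u)).obj (truthFamilies X) =>
      (leg f e.1).app X e.2 (𝟙 X)) ht
    refine Eq.trans this ?_
    change (∃ P, Connects P z ⟨e.1, (D.obj e.1).map (𝟙 X) e.2⟩) = _
    simp
  have := key z
  rw [h, key z'] at this
  exact this.mpr ⟨[], rfl⟩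

end Colimit

end GraphVK
-- Full faithfulness and essential surjectivity of κ^*.
namespace GraphVK

open Diagram

section Equivalence

variable {I : Type u₁} [Quiver.{v₁} I] {B : Type u} [SmallCategory B]
  {D : Diagram I (B ⥤ Type u)} {S : B ⥤ Type u} {κ : D ⟶ (const I (B ⥤ Type u)).obj S}

theorem pullbackHom_leg (σ : Over S) {i : I} {Y : B} (x : ((pullbackDiagram κ σ).obj i).obj Y) :
    (leg κ i).app Y ((Hom.app (pullbackHom κ σ) i).app Y x) =
      σ.hom.app Y ((leg (pullbackProj κ σ) i).app Y x) :=
  congrArg (fun f : (pullbackDiagram κ σ).obj i ⟶ S => f.app Y x)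
    (pullback.condition (f := leg κ i) (g := σ.hom))

theorem exists_leg_pullbackProj_eq (hκ : IsColimiting κ) (σ : Over S) {Y : B} (c : σ.left.obj Y) :
    ∃ (i : I) (x : ((pullbackDiagram κ σ).obj i).obj Y), (leg (pullbackProj κ σ) i).app Y x = c := by
  obtain ⟨i, y, hy⟩ := exists_leg_eq_of_isColimiting hκ (σ.hom.app Y c)
  obtain ⟨x, -, hx⟩ := exists_pullbackDiagram y c hy
  exact ⟨i, x, hx⟩

/-- The images of x and x' in D are connected. The lift of a connecting path from x ends over the
image of x' and keeps the projection to σ, so it ends at x' itself. -/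
theorem leg_eq_of_leg_pullbackProj_eq (hκ : IsColimiting κ) {σ : Over S} {T : B ⥤ Type u}
    (ρ : pullbackDiagram κ σ ⟶ (const I (B ⥤ Type u)).obj T) {Y : B}
    {x x' : Elem (pullbackDiagram κ σ) Y}
    (h : (leg (pullbackProj κ σ) x.1).app Y x.2 = (leg (pullbackProj κ σ) x'.1).app Y x'.2) :
    (leg ρ x.1).app Y x.2 = (leg ρ x'.1).app Y x'.2 := by
  obtain ⟨P, hP⟩ := exists_connects_of_isColimiting hκ
    (z := elemMap (pullbackHom κ σ) x) (z' := elemMap (pullbackHom κ σ) x')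
    ((pullbackHom_leg σ x.2).trans ((congrArg _ h).trans (pullbackHom_leg σ x'.2).symm))
  obtain ⟨⟨i, x₁⟩, Q, hQ, hx⟩ := exists_lift (τ := pullbackHom κ σ)
    (fun d => pullbackEdge_isPullback κ σ d) hP x rfl
  obtain ⟨i', x'⟩ := x'
  obtain rfl : i = i' := congrArg Sigma.fst hx
  have h₁ := eq_of_heq (Sigma.ext_iff.1 hx).2
  obtain rfl : x₁ = x' := pullbackDiagram_ext h₁ ((leg_eq_of_connects _ hQ).symm.trans h)
  exact leg_eq_of_connects ρ hQ

/-- Colimits are universal: the pullbacks of `σ` along a colimiting cocone have colimit `σ`. -/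
theorem isColimiting_pullbackProj (hκ : IsColimiting κ) (σ : Over S) :
    IsColimiting (pullbackProj κ σ) := by
  intro T ρ
  -- The factorization is defined by chosen representatives; `key` shows that the choice is
  -- irrelevant.
  choose i x hx using fun (Y : B) (c : σ.left.obj Y) => exists_leg_pullbackProj_eq hκ σ c
  have key : ∀ (Y : B) (j : I) (x' : ((pullbackDiagram κ σ).obj j).obj Y) (c : σ.left.obj Y),
      (leg (pullbackProj κ σ) j).app Y x' = c →
      (leg ρ (i Y c)).app Y (x Y c) = (leg ρ j).app Y x' := fun Y j x' c h =>
    leg_eq_of_leg_pullbackProj_eq hκ ρ (x := ⟨i Y c, x Y c⟩) (x' := ⟨j, x'⟩) ((hx Y c).trans h.symm)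
  let t : σ.left ⟶ T :=
    { app := fun Y => ↾fun c => (leg ρ (i Y c)).app Y (x Y c)
      naturality := fun Y Z g => by
        ext c
        refine (key Z (i Y c) (((pullbackDiagram κ σ).obj (i Y c)).map g (x Y c)) _ ?_).trans ?_
        · exact (NatTrans.naturality_apply (leg (pullbackProj κ σ) (i Y c)) g (x Y c)).trans
            (congrArg _ (hx Y c))
        · exact NatTrans.naturality_apply (leg ρ (i Y c)) g (x Y c) }
  refine ⟨t, hom_ext fun j => NatTrans.ext (funext fun Y => ?_), fun t' ht' => ?_⟩
  · ext x'
    exact key Y j x' _ rfl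
  · refine NatTrans.ext (funext fun Y => ?_)
    ext c
    have := congrArg (fun f : pullbackDiagram κ σ ⟶ (const I (B ⥤ Type u)).obj T =>
      (leg f (i Y c)).app Y (x Y c)) ht'
    refine Eq.trans ?_ this
    exact congrArg (t'.app Y) (hx Y c).symm

theorem pullbackMap_pullbackProj {σ σ' : Over S} (γ : σ ⟶ σ') :
    pullbackMap κ γ ≫ pullbackProj κ σ' =
      pullbackProj κ σ ≫ (const I (B ⥤ Type u)).map γ.left :=
  hom_ext fun i => pullbackComp_snd κ γ i

theorem exists_pullbackLift {E : Diagram I (B ⥤ Type u)} {σ : Over S} (τ : E ⟶ D)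
    (ρ : E ⟶ (const I (B ⥤ Type u)).obj σ.left)
    (h : τ ≫ κ = ρ ≫ (const I (B ⥤ Type u)).map σ.hom) :
    ∃ α : E ⟶ pullbackDiagram κ σ, α ≫ pullbackHom κ σ = τ ∧ α ≫ pullbackProj κ σ = ρ := by
  have hcond : ∀ i, Hom.app τ i ≫ leg κ i = leg ρ i ≫ σ.hom := fun i =>
    congrArg (fun f : E ⟶ (const I (B ⥤ Type u)).obj S => Hom.app f i) h
  let a : ∀ i, E.obj i ⟶ pullback (leg κ i) σ.hom := fun i =>
    pullback.lift (Hom.app τ i) (leg ρ i) (hcond i)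
  have ha₁ : ∀ i, a i ≫ pullback.fst _ _ = Hom.app τ i := fun i => pullback.lift_fst _ _ _
  have ha₂ : ∀ i, a i ≫ pullback.snd _ _ = leg ρ i := fun i => pullback.lift_snd _ _ _
  have hnat : ∀ {i j : I} (d : i ⟶ j), E.map d ≫ a j = a i ≫ pullbackEdge κ σ d := fun {i j} d => by
    apply pullback.hom_ext
    · rw [Category.assoc, Category.assoc, pullbackEdge_fst, ha₁, ← Category.assoc, ha₁,
        Hom.naturality]
    · rw [Category.assoc, Category.assoc, pullbackEdge_snd, ha₂, ha₂, leg_w]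
  exact ⟨⟨a, hnat⟩, hom_ext ha₁, hom_ext ha₂⟩

theorem pullbackFunctor_faithful (hκ : IsColimiting κ) : (pullbackFunctor κ).Faithful where
  map_injective {σ σ'} γ γ' h := by
    have h' : pullbackMap κ γ = pullbackMap κ γ' :=
      congrArg (fun f : (pullbackFunctor κ).obj σ ⟶ (pullbackFunctor κ).obj σ' => f.hom.left) h
    refine Over.OverMorphism.ext ((isColimiting_pullbackProj hκ σ _ _).unique
      (pullbackMap_pullbackProj γ).symm ?_)
    rw [h']
    exact (pullbackMap_pullbackProj γ').symm

/-- The universal property of the pulled-back cocone supplies the morphism between the domains, and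
its uniqueness part shows that this morphism lies over S. -/
theorem pullbackFunctor_full (hκ : IsColimiting κ) : (pullbackFunctor κ).Full where
  map_surjective {σ σ'} f := by
    let φ : pullbackDiagram κ σ ⟶ pullbackDiagram κ σ' := f.hom.left
    have hφ : φ ≫ pullbackHom κ σ' = pullbackHom κ σ := Over.w f.hom
    obtain ⟨t, ht, -⟩ := isColimiting_pullbackProj hκ σ _ (φ ≫ pullbackProj κ σ')
    have cond : ∀ σ : Over S, pullbackProj κ σ ≫ (const I (B ⥤ Type u)).map σ.hom =
        pullbackHom κ σ ≫ κ := fun σ => hom_ext fun i => (pullback.condition).symm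
    have hw : t ≫ σ'.hom = σ.hom := by
      refine (isColimiting_pullbackProj hκ σ _ (pullbackHom κ σ ≫ κ)).unique ?_ (cond σ)
      rw [Functor.map_comp, ← Category.assoc, ht, Category.assoc, cond, ← Category.assoc, hφ]
    refine ⟨Over.homMk t hw, ObjectProperty.hom_ext _ (Over.OverMorphism.ext
      (hom_ext fun i => pullback.hom_ext ?_ ?_))⟩
    · exact (pullbackComp_fst κ _ i).trans
        (congrArg (fun g : pullbackDiagram κ σ ⟶ D => Hom.app g i) hφ).symm
    · exact (pullbackComp_snd κ _ i).trans (congrArg (fun g : pullbackDiagram κ σ ⟶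
        (const I (B ⥤ Type u)).obj σ'.left => Hom.app g i) ht)

/-! ### Descent of cartesian transformations -/

section Quotient

variable (E : Diagram I (B ⥤ Type u))

/-- Elements are equivalent if they are connected by a mapping path. -/
def connectedSetoid (X : B) : Setoid (Elem E X) where
  r e e' := ∃ P, Connects P e e'
  iseqv := ⟨fun _ => ⟨[], rfl⟩, fun ⟨_, h⟩ => ⟨_, h.revPath⟩, fun ⟨_, h⟩ ⟨_, h'⟩ => ⟨_, h.append h'⟩⟩

variable {E}

/-- The action of a morphism of `B` on elements. -/
def elemAction {Y Z : B} (g : Y ⟶ Z) (e : Elem E Y) : Elem E Z := ⟨e.1, (E.obj e.1).map g e.2⟩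

theorem edgeMap_action {Y Z : B} (g : Y ⟶ Z) {i j : I} (d : i ⟶ j) (x : (E.obj i).obj Y) :
    edgeMap E Z d ((E.obj i).map g x) = (E.obj j).map g (edgeMap E Y d x) :=
  NatTrans.naturality_apply (E.map d) g x

theorem Connects.exists_action {Y Z : B} (g : Y ⟶ Z) {P : List (PathSegment E Y)} {e e' : Elem E Y}
    (h : Connects P e e') : ∃ Q, Connects Q (elemAction g e) (elemAction g e') := by
  induction P generalizing e with
  | nil => exact ⟨[], congrArg (elemAction g) h⟩
  | cons s P ih =>
    obtain ⟨rfl, h⟩ := h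
    obtain ⟨Q, hQ⟩ := ih h
    obtain ⟨i, j, d, x, rfl⟩ | ⟨i, j, d, x, rfl⟩ := s.eq_forward_or_backward
    · have := connects_forward d ((E.obj i).map g x)
      rw [edgeMap_action] at this
      exact ⟨_, this.append hQ⟩
    · have := connects_backward d ((E.obj i).map g x)
      rw [edgeMap_action] at this
      exact ⟨_, this.append hQ⟩

variable [Finite I] (E)

/-- I may live in another universe; finiteness lets its components be shrunk to `Type u`. -/
instance small_elem (X : B) : Small.{u} (Elem E X) :=
  have : Small.{u} I := Countable.toSmall I
  inferInstance

/-- The presheaf of connected components of the graphs of elements. -/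
noncomputable def components : B ⥤ Type u where
  obj X := Shrink.{u} (Quotient (connectedSetoid E X))
  map g := ↾fun c => equivShrink _ (Quotient.map (elemAction g)
    (by rintro _ _ ⟨_, h⟩; exact h.exists_action g) ((equivShrink _).symm c))
  map_id X := by
    ext c
    obtain ⟨q, rfl⟩ := (equivShrink _).surjective c
    induction q using Quotient.inductionOn with
    | _ e => simp [elemAction]
  map_comp g h := by
    ext c
    obtain ⟨q, rfl⟩ := (equivShrink _).surjective c
    induction q using Quotient.inductionOn with
    | _ e => simp [elemAction]

/-- The cocone sending an element to its connected component. -/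
noncomputable def toComponents : E ⟶ (const I (B ⥤ Type u)).obj (components E) where
  app i :=
    { app := fun X => ↾fun x => equivShrink _ (Quotient.mk (connectedSetoid E X) ⟨i, x⟩)
      naturality := fun Y Z g => by
        ext x
        simp [components, const, elemAction] }
  naturality {i j} d := by
    refine NatTrans.ext (funext fun X => ?_)
    ext x
    exact congrArg (equivShrink _) (Quotient.sound ⟨_, connects_backward d x⟩)

variable {E}

theorem toComponents_eq_iff {X : B} {e e' : Elem E X} :
    (leg (toComponents E) e.1).app X e.2 = (leg (toComponents E) e'.1).app X e'.2 ↔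
      ∃ P, Connects P e e' :=
  (equivShrink _).injective.eq_iff.trans Quotient.eq

theorem exists_toComponents_eq {X : B} (c : (components E).obj X) :
    ∃ e : Elem E X, (leg (toComponents E) e.1).app X e.2 = c := by
  obtain ⟨q, rfl⟩ := (equivShrink _).surjective c
  obtain ⟨e, rfl⟩ := Quotient.exists_rep q
  exact ⟨e, rfl⟩

/-- The factorization of a cocone through the connected components. -/
noncomputable def componentsDesc {T : B ⥤ Type u} (ρ : E ⟶ (const I (B ⥤ Type u)).obj T) :
    components E ⟶ T where
  app X := ↾fun c => Quotient.lift (fun e : Elem E X => (leg ρ e.1).app X e.2)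
    (by rintro _ _ ⟨_, h⟩; exact leg_eq_of_connects ρ h) ((equivShrink _).symm c)
  naturality Y Z g := by
    ext c
    obtain ⟨q, rfl⟩ := (equivShrink _).surjective c
    induction q using Quotient.inductionOn with
    | _ e =>
      simp only [components, TypeCat.Fun.toFun_apply, types_comp_apply, TypeCat.ofHom_apply,
        Equiv.symm_apply_apply, Quotient.map_mk, Quotient.lift_mk]
      exact NatTrans.naturality_apply (leg ρ e.1) g e.2

theorem toComponents_componentsDesc {T : B ⥤ Type u} (ρ : E ⟶ (const I (B ⥤ Type u)).obj T)
    (i : I) : leg (toComponents E) i ≫ componentsDesc ρ = leg ρ i := by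
  refine NatTrans.ext (funext fun X => ?_)
  ext x
  exact congrArg (Quotient.lift _ _) (Equiv.symm_apply_apply _ _)

end Quotient

theorem isIso_of_isIso_app {C : Type*} [Category* C] {E F : Diagram I C} (f : E ⟶ F)
    (h : ∀ i, IsIso (Hom.app f i)) : IsIso f :=
  ⟨{ app := fun i => inv (Hom.app f i)
     naturality := fun d => by
      rw [IsIso.comp_inv_eq, Category.assoc, f.naturality, IsIso.inv_hom_id_assoc] },
    hom_ext fun i => IsIso.hom_inv_id _, hom_ext fun i => IsIso.inv_hom_id _⟩

/-- The preimage of τ is the presheaf of connected components of E, mapped to S by the factorization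
of τ followed by κ. The comparison of E with its pullback is bijective on elements: injective by
trivial monodromy, surjective by path lifting. -/
theorem pullbackFunctor_essSurj [Finite I] (hκ : IsColimiting κ)
    (hsc : ∀ (X : B) (z : Elem D X) (P : List (PathSegment D X)), ¬ IsSimpleClosed P z) :
    (pullbackFunctor κ).EssSurj where
  mem_essImage F := by
    obtain ⟨⟨E, ⟨⟨⟩⟩, τ⟩, hτ⟩ := F
    change E ⟶ D at τ
    change IsCartesian τ at hτ
    let σ : Over S := Over.mk (componentsDesc (τ ≫ κ))
    obtain ⟨α, hα, hα'⟩ := exists_pullbackLift (σ := σ) τ (toComponents E)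
      (hom_ext fun i => (toComponents_componentsDesc (τ ≫ κ) i).symm)
    have hα₁ : ∀ (i : I) (Y : B) (x : (E.obj i).obj Y),
        (Hom.app (pullbackHom κ σ) i).app Y ((Hom.app α i).app Y x) = (Hom.app τ i).app Y x :=
      fun i Y x => congrArg (fun f : E ⟶ D => (Hom.app f i).app Y x) hα
    have hα₂ : ∀ (i : I) (Y : B) (x : (E.obj i).obj Y),
        (leg (pullbackProj κ σ) i).app Y ((Hom.app α i).app Y x) =
          (leg (toComponents E) i).app Y x :=
      fun i Y x => congrArg (fun f : E ⟶ (const I (B ⥤ Type u)).obj (components E) =>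
        (leg f i).app Y x) hα'
    have hiso : IsIso α := by
      refine isIso_of_isIso_app α fun i => (NatTrans.isIso_iff_isIso_app _).2 fun Y =>
        (isIso_iff_bijective _).2 ⟨fun x x' h => ?_, fun p => ?_⟩
      · have h₁ : (Hom.app τ i).app Y x = (Hom.app τ i).app Y x' := by
          rw [← hα₁, ← hα₁, h]
        have h₂ : (leg (toComponents E) i).app Y x = (leg (toComponents E) i).app Y x' := by
          rw [← hα₂, ← hα₂, h]
        obtain ⟨Q, hQ⟩ := toComponents_eq_iff (e := ⟨i, x⟩) (e' := ⟨i, x'⟩) |>.1 h₂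
        have := eq_of_connects_of_elemMap_eq hτ (hsc Y) Q hQ
          (Sigma.ext rfl (heq_of_eq h₁))
        exact eq_of_heq (Sigma.ext_iff.1 this).2
      -- A representative e of the component of p has the same image in S as p, so its image in D is
      -- connected to that of p; the end of the lifted path from e is the required preimage.
      · obtain ⟨e, he⟩ := exists_toComponents_eq ((leg (pullbackProj κ σ) i).app Y p)
        have hp := pullbackHom_leg σ p
        rw [← he] at hp
        have hσ : σ.hom.app Y ((leg (toComponents E) e.1).app Y e.2) =
            (leg κ e.1).app Y ((Hom.app τ e.1).app Y e.2) :=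
          congrArg (fun f : E.obj e.1 ⟶ S => f.app Y e.2)
            (toComponents_componentsDesc (τ ≫ κ) e.1)
        obtain ⟨P, hP⟩ := exists_connects_of_isColimiting hκ (z := elemMap τ e)
          (z' := ⟨i, (Hom.app (pullbackHom κ σ) i).app Y p⟩) (hσ.symm.trans hp.symm)
        obtain ⟨⟨i', x⟩, Q, hQ, hx⟩ := exists_lift hτ hP e rfl
        obtain rfl : i' = i := congrArg Sigma.fst hx
        refine ⟨x, pullbackDiagram_ext ?_ ?_⟩
        · rw [hα₁]
          exact eq_of_heq (Sigma.ext_iff.1 hx).2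
        · rw [hα₂, ← he]
          exact (toComponents_eq_iff (e := e) (e' := ⟨i', x⟩).2 ⟨Q, hQ⟩).symm
    exact ⟨σ, ⟨ObjectProperty.isoMk _ (Over.isoMk (f := Over.mk τ)
      (g := Over.mk (pullbackHom κ σ)) (@asIso _ _ _ _ α hiso) hα).symm⟩⟩

theorem isVanKampen_of_not_isSimpleClosed [Finite I] (hκ : IsColimiting κ)
    (hsc : ∀ (X : B) (z : Elem D X) (P : List (PathSegment D X)), ¬ IsSimpleClosed P z) :
    IsVanKampen κ where
  faithful := pullbackFunctor_faithful hκ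
  full := pullbackFunctor_full hκ
  essSurj := pullbackFunctor_essSurj hκ hsc

end Equivalence

end GraphVK

theorem theorem6p12 {B : Type u} [SmallCategory B]
    {I : Type u₁} [Quiver.{v₁} I] [Finite I] [Finite (Quiver.Total I)]
    (hI : GraphVK.NoDirectedCycles I)
    (D : GraphVK.Diagram I (B ⥤ Type u)) (hD : GraphVK.ImageDisjoint D)
    (S : B ⥤ Type u) (κ : D ⟶ (GraphVK.Diagram.const I (B ⥤ Type u)).obj S)
    (hκ : GraphVK.Diagram.IsColimiting κ) :
    List.TFAE [
      GraphVK.Diagram.IsVanKampen κ,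
      ∀ (X : B) (i j : I), GraphVK.IsAffected i → GraphVK.IsAffected j →
        ∀ (z : (D.obj i).obj X) (z' : (D.obj j).obj X),
          ¬ ∃ P P' : List (GraphVK.PathSegment D X), P ≠ P' ∧
            GraphVK.Connects P ⟨i, z⟩ ⟨j, z'⟩ ∧ GraphVK.IsProper P ∧
            GraphVK.Connects P' ⟨i, z⟩ ⟨j, z'⟩ ∧ GraphVK.IsProper P',
      ∀ (X : B) (i j : I), GraphVK.IsAffected i → GraphVK.IsAffected j →
        ∀ (z : (D.obj i).obj X) (z' : (D.obj j).obj X),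
          ¬ ∃ P P' : List (GraphVK.PathSegment D X), P ≠ P' ∧
            GraphVK.Connects P ⟨i, z⟩ ⟨j, z'⟩ ∧ GraphVK.IsProper P ∧
            GraphVK.IsInnerCycleFree P ∧
            GraphVK.Connects P' ⟨i, z⟩ ⟨j, z'⟩ ∧ GraphVK.IsProper P' ∧
            GraphVK.IsInnerCycleFree P'] := by
  tfae_have 1 → 2 := by
    rintro h X i j - - z z' ⟨P, P', hne, hP, hp, hP', hp'⟩
    exact hne (GraphVK.path_unique_of_isVanKampen h hP hp hP' hp')
  tfae_have 2 → 3 := by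
    rintro h X i j hi hj z z' ⟨P, P', hne, hP, hp, -, hP', hp', -⟩
    exact h X i j hi hj z z' ⟨P, P', hne, hP, hp, hP', hp'⟩
  tfae_have 3 → 1 := by
    intro h
    refine GraphVK.isVanKampen_of_not_isSimpleClosed hκ fun X z =>
      GraphVK.not_isSimpleClosed hI hD (fun z z' hz hz' P P' hP hp hi hP' hp' hi' => ?_) z
    by_contra hne
    exact h X z.1 z'.1 hz hz' z.2 z'.2 ⟨P, P', hne, hP, hp, hi, hP', hp', hi'⟩
  tfae_finish
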